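/- Let $(V,Y,\mathbf 1,\omega)$ be a vertex operator algebra over $\mathbb C$, and let $L(n)=\omega_{n+1}$. A weak module for $V$ (or for the tensor product vertex operator algebra $V\otimes V$) is a vector space $M$ with a linear map $Y_M(\cdot,x)$ into $(\mathrm{End}\,M)[[x,x^{-1}]]$ such that $Y_M(v,x)w\in M((x))$ for all $v,w$, $Y_M(\mathbf 1,x)=1$, and the Jacobi identity holds; no grading is required. Let $A$ be a weak $V\otimes V$-module, let $z$ be a nonzero complex number, and let $A^*$ be the algebraic dual of $A$. For $v\in V$ put $Y_1(v,x)=Y_A(v\otimes\mathbf 1,x)$, $Y_2(v,x)=Y_A(\mathbf 1\otimes v,x)$ and $Y_1^o(v,x)=Y_1(e^{xL(1)}(-x^{-2})^{L(0)}v,x^{-1})$. Let $\delta(x)=\sum_{n\in\mathbb Z}x^n$, and expand all binomials in nonnegative powers of the second term. Define a linear map $Y'_{Q(z)}:V\to(\mathrm{End}\,A^*)[[x_0,x_0^{-1}]]$ by $$\langle Y'_{Q(z)}(v,x_0)\lambda,a\rangle=\mathrm{Res}_{x_1}x_0^{-1}\delta\Big(\frac{x_1-z}{x_0}\Big)\langle\lambda,Y_1^o(v,x_1)a\rangle-\mathrm{Res}_{x_1}x_0^{-1}\delta\Big(\frac{z-x_1}{-x_0}\Big)\langle\lambda,Y_2(v,x_1)a\rangle$$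 for $v\in V$, $\lambda\in A^*$, $a\in A$. Let $\tilde T'_{Q(z)}(A)\subset A^*$ be the subspace of all $\lambda$ that satisfy the Huang–Lepowsky $Q(z)$-compatibility condition: (a) $Y'_{Q(z)}(v,x)\lambda\in A^*((x))$ for all $v\in V$; (b) for all $v\in V$ and $a\in A$, $$z^{-1}\delta\Big(\frac{x_1-x_0}{z}\Big)\langle Y'_{Q(z)}(v,x_0)\lambda,a\rangle=x_0^{-1}\delta\Big(\frac{x_1-z}{x_0}\Big)\langle\lambda,Y_1^o(v,x_1)a\rangle-x_0^{-1}\delta\Big(\frac{z-x_1}{-x_0}\Big)\langle\lambda,Y_2(v,x_1)a\rangle.$$ **Theorem.** The subspace $\tilde T'_{Q(z)}(A)$ is stable under all coefficients of $Y'_{Q(z)}(v,x_0)$, $v\in V$, and the pair $(\tilde T'_{Q(z)}(A),Y'_{Q(z)})$ is a weak $V$-module. -/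

import Mathlib

open scoped TensorProduct

/-! ### Vertex operators through their modes

A formal series `Y(v, x) = ∑ₙ vₙ x^{-n-1}` with coefficients in `End M`, depending linearly on
`v ∈ V`, is recorded by its modes: `Y v n` is `vₙ`, the coefficient of `x^{-n-1}`. -/

/-- Linear maps `V → (End M)[[x, x⁻¹]]`; `Y v n` is the coefficient of `x^{-n-1}` in `Y(v, x)`. -/
abbrev Modes (V M : Type*) [AddCommGroup V] [Module ℂ V] [AddCommGroup M] [Module ℂ M] :=
  V →ₗ[ℂ] ℤ → Module.End ℂ M

/-- `Y(v, x) w ∈ M((x))` for all `v` and `w`: the modes `vₙ w` vanish for all large `n`. -/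
def LowerTruncated {V M : Type*} [AddCommGroup V] [Module ℂ V] [AddCommGroup M] [Module ℂ M]
    (Y : Modes V M) : Prop :=
  ∀ (v : V) (w : M), ∃ N : ℤ, ∀ n : ℤ, N ≤ n → Y v n w = 0

/-- The Jacobi identity
`x₀⁻¹ δ((x₁-x₂)/x₀) Y_M(u,x₁) Y_M(v,x₂) w - x₀⁻¹ δ((x₂-x₁)/(-x₀)) Y_M(v,x₂) Y_M(u,x₁) w`
`  = x₂⁻¹ δ((x₁-x₀)/x₂) Y_M(Y_V(u,x₀)v, x₂) w`,
written out as the equality of the coefficients of `x₀^{-l-1} x₁^{-m-1} x₂^{-n-1}`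
for all integers `l, m, n` (with
`x₂⁻¹ δ((x₁-x₀)/x₂) = x₁⁻¹ δ((x₂+x₀)/x₁) = ∑ₘ x₁^{-m-1} (x₂+x₀)^m`).  All the sums have only
finitely many nonzero terms when `YV` and `YM` are lower truncated. -/
def JacobiIdentity {V M : Type*} [AddCommGroup V] [Module ℂ V] [AddCommGroup M] [Module ℂ M]
    (YV : Modes V V) (YM : Modes V M) : Prop :=
  ∀ (u v : V) (w : M) (l m n : ℤ),
    (∑ᶠ i : ℕ, ((-1 : ℂ) ^ i * (Ring.choose l i : ℤ)) • YM u (l + m - i) (YM v (n + i) w))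
      - (-1 : ℂ) ^ l •
        (∑ᶠ i : ℕ, ((-1 : ℂ) ^ i * (Ring.choose l i : ℤ)) • YM v (l + n - i) (YM u (m + i) w))
      = ∑ᶠ i : ℕ, ((Ring.choose m i : ℤ) : ℂ) • YM (YV u (l + i) v) (m + n - i) w

/-- The data of a vertex operator map `Y` and a vacuum vector on `V`: what the notion of a weak
module refers to. -/
structure VertexData (V : Type*) [AddCommGroup V] [Module ℂ V] where
  /-- the vertex operator map -/
  Y : Modes V V
  /-- the vacuum vector -/
  vacuum : V

/-- A vertex operator algebra `(V, Y, 𝟏, ω)` over `ℂ`. The modes of `ω` are `L(n) = ω_{n+1}`, and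
the grading is `V_(n) = {v | L(0) v = n v}`, `n ∈ ℤ`. -/
structure VertexOperatorAlgebra (V : Type*) [AddCommGroup V] [Module ℂ V] extends
    VertexData V where
  /-- the Virasoro (conformal) element `ω` -/
  conformal : V
  /-- the central charge (rank) -/
  centralCharge : ℂ
  truncation : LowerTruncated Y
  vacuum_mode : ∀ n : ℤ, Y vacuum n = if n = -1 then 1 else 0
  creation_nonneg : ∀ (v : V) (n : ℤ), 0 ≤ n → Y v n vacuum = 0
  creation : ∀ v : V, Y v (-1) vacuum = v
  jacobi : JacobiIdentity Y Y
  /-- `[L(m), L(n)] = (m - n) L(m+n) + (m³ - m)/12 δ_{m+n,0} c` -/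
  virasoro : ∀ m n : ℤ,
    Y conformal (m + 1) * Y conformal (n + 1) - Y conformal (n + 1) * Y conformal (m + 1)
      = ((m : ℂ) - n) • Y conformal (m + n + 1)
        + (if m + n = 0 then ((m : ℂ) ^ 3 - m) / 12 * centralCharge else 0) •
          (1 : Module.End ℂ V)
  /-- `d/dx Y(v, x) = Y(L(-1) v, x)` -/
  derivative : ∀ (v : V) (n : ℤ), Y (Y conformal 0 v) n = (-(n : ℂ)) • Y v (n - 1)
  grading : DirectSum.IsInternal
    (fun n : ℤ => Module.End.eigenspace (Y conformal 1) (n : ℂ))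
  finite_dimensional : ∀ n : ℤ,
    FiniteDimensional ℂ (Module.End.eigenspace (Y conformal 1) (n : ℂ))
  bounded_below : ∃ N : ℤ, ∀ n : ℤ, n < N →
    Module.End.eigenspace (Y conformal 1) (n : ℂ) = ⊥

/-- A weak module for `(V, Y, 𝟏)`: truncation, vacuum property and Jacobi identity, with no grading
required. (The Virasoro relations and the `L(-1)`-derivative property on `M` are consequences of
these axioms when `V` is a vertex operator algebra.) -/
structure WeakModule {V : Type*} [AddCommGroup V] [Module ℂ V] (P : VertexData V)
    (M : Type*) [AddCommGroup M] [Module ℂ M] where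
  /-- the vertex operator map of the module -/
  Y : Modes V M
  truncation : LowerTruncated Y
  vacuum_mode : ∀ n : ℤ, Y P.vacuum n = if n = -1 then 1 else 0
  jacobi : JacobiIdentity P.Y Y

noncomputable section

namespace VertexOperatorAlgebra

variable {V : Type*} [AddCommGroup V] [Module ℂ V] (𝒱 : VertexOperatorAlgebra V)

/-- `L(n) = ω_{n+1}`, where `Y(ω, x) = ∑ₙ L(n) x^{-n-2}`. -/
def L (n : ℤ) : Module.End ℂ V := 𝒱.Y 𝒱.conformal (n + 1)

/-- The homogeneous subspace `V_(n)`. -/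
def weightSpace (n : ℤ) : Submodule ℂ V := Module.End.eigenspace (𝒱.Y 𝒱.conformal 1) (n : ℂ)

/-- `V ≅ ⨁ V_(n)`. -/
def gradingEquiv : (DirectSum ℤ fun n => 𝒱.weightSpace n) ≃ₗ[ℂ] V :=
  LinearEquiv.ofBijective (DirectSum.coeLinearMap 𝒱.weightSpace) 𝒱.grading

/-! #### The tensor product `V ⊗ V` -/

theorem tensor_finite (u v a b : V) (n : ℤ) :
    (Function.support fun i : ℤ => 𝒱.Y u i a ⊗ₜ[ℂ] 𝒱.Y v (n - 1 - i) b).Finite := by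
  obtain ⟨N₁, h₁⟩ := 𝒱.truncation u a
  obtain ⟨N₂, h₂⟩ := 𝒱.truncation v b
  refine (Set.finite_Icc (n - 1 - N₂) N₁).subset fun i hi => ?_
  rw [Function.mem_support] at hi
  constructor
  · by_contra h
    exact hi (by rw [h₂ _ (by omega), TensorProduct.tmul_zero])
  · by_contra h
    exact hi (by rw [h₁ _ (by omega), TensorProduct.zero_tmul])

/-- The mode `(u ⊗ v)ₙ` on `V ⊗ V`, determined by
`(u ⊗ v)ₙ (a ⊗ b) = ∑_{i + j = n - 1} uᵢ a ⊗ vⱼ b`, that is,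
`Y(u ⊗ v, x) = Y(u, x) ⊗ Y(v, x)`. -/
def tensorMode (u v : V) (n : ℤ) : Module.End ℂ (V ⊗[ℂ] V) :=
  TensorProduct.lift <| LinearMap.mk₂ ℂ
    (fun a b => ∑ᶠ i : ℤ, 𝒱.Y u i a ⊗ₜ[ℂ] 𝒱.Y v (n - 1 - i) b)
    (fun a a' b => by
      rw [← finsum_add_distrib (𝒱.tensor_finite ..) (𝒱.tensor_finite ..)]
      simp only [map_add, TensorProduct.add_tmul])
    (fun c a b => by
      rw [smul_finsum' _ (𝒱.tensor_finite ..)]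
      simp only [map_smul, TensorProduct.smul_tmul'])
    (fun a b b' => by
      rw [← finsum_add_distrib (𝒱.tensor_finite ..) (𝒱.tensor_finite ..)]
      simp only [map_add, TensorProduct.tmul_add])
    (fun c a b => by
      rw [smul_finsum' _ (𝒱.tensor_finite ..)]
      simp only [map_smul, TensorProduct.tmul_smul])

theorem tensorMode_tmul (u v a b : V) (n : ℤ) :
    𝒱.tensorMode u v n (a ⊗ₜ[ℂ] b) = ∑ᶠ i : ℤ, 𝒱.Y u i a ⊗ₜ[ℂ] 𝒱.Y v (n - 1 - i) b := rfl

/-- The tensor product `V ⊗ V`, with `Y(u ⊗ v, x) = Y(u, x) ⊗ Y(v, x)` and vacuum `𝟏 ⊗ 𝟏`. -/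
def tensorSquare : VertexData (V ⊗[ℂ] V) where
  Y := TensorProduct.lift <| LinearMap.mk₂ ℂ (fun u v n => 𝒱.tensorMode u v n)
    (fun u u' v => by
      funext n
      refine TensorProduct.ext' fun a b => ?_
      simp only [Pi.add_apply, LinearMap.add_apply, tensorMode_tmul]
      rw [← finsum_add_distrib (𝒱.tensor_finite ..) (𝒱.tensor_finite ..)]
      simp only [map_add, Pi.add_apply, LinearMap.add_apply, TensorProduct.add_tmul])
    (fun c u v => by
      funext n
      refine TensorProduct.ext' fun a b => ?_
      simp only [Pi.smul_apply, LinearMap.smul_apply, tensorMode_tmul]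
      rw [smul_finsum' _ (𝒱.tensor_finite ..)]
      simp only [map_smul, Pi.smul_apply, LinearMap.smul_apply, TensorProduct.smul_tmul'])
    (fun u v v' => by
      funext n
      refine TensorProduct.ext' fun a b => ?_
      simp only [Pi.add_apply, LinearMap.add_apply, tensorMode_tmul]
      rw [← finsum_add_distrib (𝒱.tensor_finite ..) (𝒱.tensor_finite ..)]
      simp only [map_add, Pi.add_apply, LinearMap.add_apply, TensorProduct.tmul_add])
    (fun c u v => by
      funext n
      refine TensorProduct.ext' fun a b => ?_
      simp only [Pi.smul_apply, LinearMap.smul_apply, tensorMode_tmul]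
      rw [smul_finsum' _ (𝒱.tensor_finite ..)]
      simp only [map_smul, Pi.smul_apply, LinearMap.smul_apply, TensorProduct.tmul_smul])
  vacuum := 𝒱.vacuum ⊗ₜ[ℂ] 𝒱.vacuum

/-! #### Opposite vertex operators -/

/-- The coefficient of `x^k` in `e^{x L(1)} (-x^{-2})^{L(0)} v ∈ V[x, x⁻¹]`.  For `v ∈ V_(h)` this
Laurent polynomial is `∑_{j ≥ 0} (-1)^h / j! x^{j - 2h} L(1)^j v`, so that `j = k + 2h`. -/
def oppositeCoeff (k : ℤ) : V →ₗ[ℂ] V :=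
  (DirectSum.toModule ℂ ℤ V fun h : ℤ =>
    if 0 ≤ k + 2 * h then
      (((-1 : ℂ) ^ h / ((k + 2 * h).toNat.factorial : ℂ)) •
        ((𝒱.L 1) ^ (k + 2 * h).toNat)).comp (𝒱.weightSpace h).subtype
    else 0).comp 𝒱.gradingEquiv.symm.toLinearMap

theorem oppositeCoeff_of_mem (k h : ℤ) {v : V} (hv : v ∈ 𝒱.weightSpace h) :
    𝒱.oppositeCoeff k v = if 0 ≤ k + 2 * h then
      ((-1 : ℂ) ^ h / ((k + 2 * h).toNat.factorial : ℂ)) •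
        ((𝒱.L 1) ^ (k + 2 * h).toNat) v else 0 := by
  have h₁ : 𝒱.gradingEquiv.symm v = DirectSum.lof ℂ ℤ (fun n => 𝒱.weightSpace n) h ⟨v, hv⟩ := by
    rw [LinearEquiv.symm_apply_eq]
    exact (DirectSum.coeLinearMap_lof (fun n => 𝒱.weightSpace n) h ⟨v, hv⟩).symm
  rw [oppositeCoeff, LinearMap.comp_apply, LinearEquiv.coe_coe, h₁, DirectSum.toModule_lof]
  split_ifs <;> simp

theorem L_one_mem {h : ℤ} {v : V} (hv : v ∈ 𝒱.weightSpace h) :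
    𝒱.L 1 v ∈ 𝒱.weightSpace (h - 1) := by
  have h₁ := LinearMap.congr_fun (𝒱.virasoro 0 1) v
  rw [weightSpace, Module.End.mem_eigenspace_iff] at hv ⊢
  simp only [LinearMap.sub_apply, Module.End.mul_apply, LinearMap.add_apply,
    LinearMap.smul_apply, zero_add] at h₁
  rw [hv] at h₁
  simp only [map_smul, Int.cast_zero, Int.cast_one] at h₁
  simp only [one_ne_zero, if_false, zero_smul, add_zero] at h₁
  rw [sub_eq_iff_eq_add] at h₁
  simp only [L]
  rw [h₁, ← add_smul]
  congr 1
  push_cast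
  ring

theorem L_one_pow_mem {h : ℤ} {v : V} (hv : v ∈ 𝒱.weightSpace h) (j : ℕ) :
    ((𝒱.L 1) ^ j) v ∈ 𝒱.weightSpace (h - j) := by
  induction j with
  | zero => simpa using hv
  | succ j ih =>
    rw [pow_succ', Module.End.mul_apply]
    have := 𝒱.L_one_mem ih
    rwa [sub_sub, ← Nat.cast_succ] at this

/-- `e^{x L(1)} (-x^{-2})^{L(0)} v` is a Laurent polynomial. -/
theorem oppositeCoeff_finite (v : V) :
    (Function.support fun k : ℤ => 𝒱.oppositeCoeff k v).Finite := by
  obtain ⟨N, hN⟩ := 𝒱.bounded_below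
  obtain ⟨s, rfl⟩ := 𝒱.gradingEquiv.surjective v
  induction s using DirectSum.induction_on with
  | zero => simp
  | add s t hs ht =>
    refine (hs.union ht).subset ?_
    simp only [map_add]
    exact Function.support_add _ _
  | of h v =>
    have hv : 𝒱.gradingEquiv (DirectSum.of (fun n => 𝒱.weightSpace n) h v) = (v : V) :=
      DirectSum.coeLinearMap_of (fun n => 𝒱.weightSpace n) h v
    rw [hv]
    refine (Set.finite_Icc (-2 * h) (-h - N)).subset fun k hk => ?_
    rw [Function.mem_support, 𝒱.oppositeCoeff_of_mem k h v.2] at hk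
    by_cases h₀ : 0 ≤ k + 2 * h
    · rw [if_pos h₀] at hk
      refine ⟨by omega, ?_⟩
      by_contra h₁
      have h₂ := 𝒱.L_one_pow_mem v.2 (k + 2 * h).toNat
      rw [weightSpace, hN _ (by omega), Submodule.mem_bot] at h₂
      exact hk (by rw [h₂, smul_zero])
    · exact absurd (if_neg h₀) hk

theorem opposite_finite {M : Type*} [AddCommGroup M] [Module ℂ M] (Y : Modes V M) (v : V) (m : ℤ) :
    (Function.support fun k : ℤ => Y (𝒱.oppositeCoeff k v) (-m - 2 - k)).Finite := by
  refine (𝒱.oppositeCoeff_finite v).subset fun k hk hk' => hk ?_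
  simp only at hk' ⊢
  rw [hk', map_zero, Pi.zero_apply]

/-- The opposite vertex operator `Y^o(v, x) = Y(e^{x L(1)} (-x^{-2})^{L(0)} v, x⁻¹)`.  If
`e^{x L(1)} (-x^{-2})^{L(0)} v = ∑ₖ vᵏ x^k`, then the coefficient of `x^{-m-1}` in
`Y^o(v, x) = ∑_{k,n} (vᵏ)ₙ x^{k+n+1}` is `∑ₖ (vᵏ)_{-m-2-k}`. -/
def opposite {M : Type*} [AddCommGroup M] [Module ℂ M] (Y : Modes V M) : Modes V M where
  toFun v m := ∑ᶠ k : ℤ, Y (𝒱.oppositeCoeff k v) (-m - 2 - k)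
  map_add' u v := by
    funext m
    rw [Pi.add_apply, ← finsum_add_distrib (𝒱.opposite_finite ..) (𝒱.opposite_finite ..)]
    simp only [map_add, Pi.add_apply]
  map_smul' c v := by
    funext m
    rw [Pi.smul_apply, RingHom.id_apply, smul_finsum' _ (𝒱.opposite_finite ..)]
    simp only [map_smul, Pi.smul_apply]

theorem opposite_apply {M : Type*} [AddCommGroup M] [Module ℂ M] (Y : Modes V M) (v : V) (m : ℤ) :
    𝒱.opposite Y v m = ∑ᶠ k : ℤ, Y (𝒱.oppositeCoeff k v) (-m - 2 - k) := rfl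

/-- `Y^o(v, x) w ∈ M((x⁻¹))` if `Y` is lower truncated. -/
theorem opposite_truncation {M : Type*} [AddCommGroup M] [Module ℂ M] {Y : Modes V M}
    (hY : LowerTruncated Y) (v : V) (w : M) :
    ∃ N : ℤ, ∀ m : ℤ, m ≤ N → 𝒱.opposite Y v m w = 0 := by
  choose B hB using fun k : ℤ => hY (𝒱.oppositeCoeff k v) w
  obtain ⟨N, hN⟩ := ((𝒱.oppositeCoeff_finite v).image fun k => -2 - k - B k).bddBelow
  refine ⟨N, fun m hm => ?_⟩
  rw [opposite_apply]
  change LinearMap.applyₗ w _ = 0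
  rw [map_finsum _ (𝒱.opposite_finite ..)]
  refine finsum_eq_zero_of_forall_eq_zero fun k => ?_
  by_cases hk : 𝒱.oppositeCoeff k v = 0
  · simp [hk]
  · have h₁ := hN ⟨k, hk, rfl⟩
    exact hB k _ (by simp only at h₁; omega)

end VertexOperatorAlgebra

/-! ### The `Q(z)`-compatibility condition -/

namespace WeakModule

variable {V : Type*} [AddCommGroup V] [Module ℂ V] {𝒱 : VertexOperatorAlgebra V}
  {A : Type*} [AddCommGroup A] [Module ℂ A] (𝒜 : WeakModule 𝒱.tensorSquare A)

/-- `Y₁(v, x) = Y(v ⊗ 𝟏, x)` on a weak `V ⊗ V`-module. -/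
def Y₁ : Modes V A := 𝒜.Y.comp ((TensorProduct.mk ℂ V V).flip 𝒱.vacuum)

/-- `Y₂(v, x) = Y(𝟏 ⊗ v, x)` on a weak `V ⊗ V`-module. -/
def Y₂ : Modes V A := 𝒜.Y.comp (TensorProduct.mk ℂ V V 𝒱.vacuum)

theorem Y₁_apply (v : V) : 𝒜.Y₁ v = 𝒜.Y (v ⊗ₜ[ℂ] 𝒱.vacuum) := rfl

theorem Y₂_apply (v : V) : 𝒜.Y₂ v = 𝒜.Y (𝒱.vacuum ⊗ₜ[ℂ] v) := rfl

/-- The `i`-th term of the coefficient of `x₀^{-p-1} x₁^{-q-1}` in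
`x₀⁻¹ δ((x₁-z)/x₀) ⟨f, Y₁^o(v,x₁) a⟩ = ∑_{p,i} x₀^{-p-1} C(p,i) (-z)^i x₁^{p-i} ⟨f, Y₁^o(v,x₁) a⟩`. -/
def firstTerm (z : ℂ) (f : Module.Dual ℂ A) (v : V) (a : A) (p q : ℤ) (i : ℕ) : ℂ :=
  ((Ring.choose p i : ℤ) : ℂ) * (-z) ^ i * f (𝒱.opposite 𝒜.Y₁ v (p + q - i) a)

/-- The `i`-th term of the coefficient of `x₀^{-p-1} x₁^{-q-1}` in
`x₀⁻¹ δ((z-x₁)/(-x₀)) ⟨f, Y₂(v,x₁) a⟩`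
`  = ∑_{p,i} (-1)^p x₀^{-p-1} C(p,i) (-1)^i z^{p-i} x₁^i ⟨f, Y₂(v,x₁) a⟩`. -/
def secondTerm (z : ℂ) (f : Module.Dual ℂ A) (v : V) (a : A) (p q : ℤ) (i : ℕ) : ℂ :=
  (-1) ^ p * ((Ring.choose p i : ℤ) : ℂ) * (-1) ^ i * z ^ (p - i) * f (𝒜.Y₂ v (q + i) a)

/-- The coefficient of `x₀^{-p-1} x₁^{-q-1}` in
`x₀⁻¹ δ((x₁-z)/x₀) ⟨f, Y₁^o(v,x₁) a⟩ - x₀⁻¹ δ((z-x₁)/(-x₀)) ⟨f, Y₂(v,x₁) a⟩`.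
Both sums have only finitely many nonzero terms. -/
def deltaCoeff (z : ℂ) (f : Module.Dual ℂ A) (v : V) (a : A) (p q : ℤ) : ℂ :=
  (∑ᶠ i : ℕ, 𝒜.firstTerm z f v a p q i) - ∑ᶠ i : ℕ, 𝒜.secondTerm z f v a p q i

theorem firstTerm_finite (z : ℂ) (f : Module.Dual ℂ A) (v : V) (a : A) (p q : ℤ) :
    (Function.support (𝒜.firstTerm z f v a p q)).Finite := by
  obtain ⟨N, hN⟩ := 𝒱.opposite_truncation (Y := 𝒜.Y₁)
    (fun v w => 𝒜.truncation (v ⊗ₜ[ℂ] 𝒱.vacuum) w) v a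
  refine (Set.finite_Iic (p + q - N).toNat).subset fun i hi => ?_
  by_contra h
  rw [Set.mem_Iic] at h
  exact hi (by rw [firstTerm, hN _ (by omega), map_zero, mul_zero])

theorem secondTerm_finite (z : ℂ) (f : Module.Dual ℂ A) (v : V) (a : A) (p q : ℤ) :
    (Function.support (𝒜.secondTerm z f v a p q)).Finite := by
  obtain ⟨N, hN⟩ := 𝒜.truncation (𝒱.vacuum ⊗ₜ[ℂ] v) a
  refine (Set.finite_Iic (N - q).toNat).subset fun i hi => ?_
  by_contra h
  rw [Set.mem_Iic] at h
  exact hi (by rw [secondTerm, Y₂_apply, hN _ (by omega), map_zero, mul_zero])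

theorem deltaCoeff_add_functional (z : ℂ) (f g : Module.Dual ℂ A) (v : V) (a : A) (p q : ℤ) :
    𝒜.deltaCoeff z (f + g) v a p q = 𝒜.deltaCoeff z f v a p q + 𝒜.deltaCoeff z g v a p q := by
  simp only [deltaCoeff]
  rw [← add_sub_add_comm, ← finsum_add_distrib (𝒜.firstTerm_finite ..) (𝒜.firstTerm_finite ..),
    ← finsum_add_distrib (𝒜.secondTerm_finite ..) (𝒜.secondTerm_finite ..)]
  simp only [firstTerm, secondTerm, LinearMap.add_apply, mul_add]

theorem deltaCoeff_smul_functional (z c : ℂ) (f : Module.Dual ℂ A) (v : V) (a : A) (p q : ℤ) :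
    𝒜.deltaCoeff z (c • f) v a p q = c * 𝒜.deltaCoeff z f v a p q := by
  simp only [deltaCoeff]
  rw [mul_sub, mul_finsum' _ _ (𝒜.firstTerm_finite ..), mul_finsum' _ _ (𝒜.secondTerm_finite ..)]
  simp only [firstTerm, secondTerm, LinearMap.smul_apply, smul_eq_mul, mul_left_comm _ c]

theorem deltaCoeff_add_vector (z : ℂ) (f : Module.Dual ℂ A) (v : V) (a b : A) (p q : ℤ) :
    𝒜.deltaCoeff z f v (a + b) p q = 𝒜.deltaCoeff z f v a p q + 𝒜.deltaCoeff z f v b p q := by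
  simp only [deltaCoeff]
  rw [← add_sub_add_comm, ← finsum_add_distrib (𝒜.firstTerm_finite ..) (𝒜.firstTerm_finite ..),
    ← finsum_add_distrib (𝒜.secondTerm_finite ..) (𝒜.secondTerm_finite ..)]
  simp only [firstTerm, secondTerm, map_add, mul_add]

theorem deltaCoeff_smul_vector (z c : ℂ) (f : Module.Dual ℂ A) (v : V) (a : A) (p q : ℤ) :
    𝒜.deltaCoeff z f v (c • a) p q = c * 𝒜.deltaCoeff z f v a p q := by
  simp only [deltaCoeff]
  rw [mul_sub, mul_finsum' _ _ (𝒜.firstTerm_finite ..), mul_finsum' _ _ (𝒜.secondTerm_finite ..)]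
  simp only [firstTerm, secondTerm, map_smul, smul_eq_mul, mul_left_comm _ c]

theorem deltaCoeff_add (z : ℂ) (f : Module.Dual ℂ A) (u v : V) (a : A) (p q : ℤ) :
    𝒜.deltaCoeff z f (u + v) a p q = 𝒜.deltaCoeff z f u a p q + 𝒜.deltaCoeff z f v a p q := by
  simp only [deltaCoeff]
  rw [← add_sub_add_comm, ← finsum_add_distrib (𝒜.firstTerm_finite ..) (𝒜.firstTerm_finite ..),
    ← finsum_add_distrib (𝒜.secondTerm_finite ..) (𝒜.secondTerm_finite ..)]
  simp only [firstTerm, secondTerm, map_add, Pi.add_apply, LinearMap.add_apply, mul_add]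

theorem deltaCoeff_smul (z c : ℂ) (f : Module.Dual ℂ A) (v : V) (a : A) (p q : ℤ) :
    𝒜.deltaCoeff z f (c • v) a p q = c * 𝒜.deltaCoeff z f v a p q := by
  simp only [deltaCoeff]
  rw [mul_sub, mul_finsum' _ _ (𝒜.firstTerm_finite ..), mul_finsum' _ _ (𝒜.secondTerm_finite ..)]
  simp only [firstTerm, secondTerm, map_smul, Pi.smul_apply, LinearMap.smul_apply, smul_eq_mul,
    mul_left_comm _ c]

/-- The vertex operator map `Y'_{Q(z)} : V → (End A^*)[[x₀, x₀⁻¹]]`,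
`⟨Y'_{Q(z)}(v,x₀) f, a⟩ = Res_{x₁} x₀⁻¹ δ((x₁-z)/x₀) ⟨f, Y₁^o(v,x₁) a⟩`
`  - Res_{x₁} x₀⁻¹ δ((z-x₁)/(-x₀)) ⟨f, Y₂(v,x₁) a⟩`. -/
def YQ (z : ℂ) : Modes V (Module.Dual ℂ A) where
  toFun v p :=
    { toFun := fun f =>
        { toFun := fun a => 𝒜.deltaCoeff z f v a p 0
          map_add' := fun a b => 𝒜.deltaCoeff_add_vector z f v a b p 0
          map_smul' := fun c a => 𝒜.deltaCoeff_smul_vector z c f v a p 0 }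
      map_add' := fun f g => LinearMap.ext fun a => 𝒜.deltaCoeff_add_functional z f g v a p 0
      map_smul' := fun c f => LinearMap.ext fun a => 𝒜.deltaCoeff_smul_functional z c f v a p 0 }
  map_add' u v := by
    funext p
    ext f a
    exact 𝒜.deltaCoeff_add z f u v a p 0
  map_smul' c v := by
    funext p
    ext f a
    exact 𝒜.deltaCoeff_smul z c f v a p 0

theorem YQ_apply (z : ℂ) (v : V) (p : ℤ) (f : Module.Dual ℂ A) (a : A) :
    𝒜.YQ z v p f a = 𝒜.deltaCoeff z f v a p 0 := rfl

/-- The Huang–Lepowsky `Q(z)`-compatibility condition for a linear functional `f` on `A`. -/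
structure QCompatible (z : ℂ) (f : Module.Dual ℂ A) : Prop where
  /-- `Y'_{Q(z)}(v, x) f ∈ A^*((x))` -/
  lower_truncation : ∀ v : V, ∃ N : ℤ, ∀ p : ℤ, N ≤ p → 𝒜.YQ z v p f = 0
  /-- `z⁻¹ δ((x₁-x₀)/z) ⟨Y'_{Q(z)}(v,x₀) f, a⟩`
  `= x₀⁻¹ δ((x₁-z)/x₀) ⟨f, Y₁^o(v,x₁) a⟩ - x₀⁻¹ δ((z-x₁)/(-x₀)) ⟨f, Y₂(v,x₁) a⟩`,
  as the equality of the coefficients of `x₀^{-p-1} x₁^{-q-1}` for all integers `p, q`, with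
  `z⁻¹ δ((x₁-x₀)/z) = x₁⁻¹ δ((z+x₀)/x₁) = ∑_{q,i} x₁^{-q-1} C(q,i) z^{q-i} x₀^i`.
  The sum is finite by lower truncation. -/
  jacobi : ∀ (v : V) (a : A) (p q : ℤ),
    ∑ᶠ i : ℕ, ((Ring.choose q i : ℤ) : ℂ) * z ^ (q - i) * 𝒜.YQ z v (p + i) f a
      = 𝒜.deltaCoeff z f v a p q

theorem left_finite {z : ℂ} {f : Module.Dual ℂ A}
    (h : ∀ v : V, ∃ N : ℤ, ∀ p : ℤ, N ≤ p → 𝒜.YQ z v p f = 0) (v : V) (a : A) (p q : ℤ) :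
    (Function.support fun i : ℕ =>
      ((Ring.choose q i : ℤ) : ℂ) * z ^ (q - i) * 𝒜.YQ z v (p + i) f a).Finite := by
  obtain ⟨N, hN⟩ := h v
  refine (Set.finite_Iic (N - p).toNat).subset fun i hi => ?_
  by_contra h
  rw [Set.mem_Iic] at h
  exact hi (by simp only [hN _ (show N ≤ p + i by omega), LinearMap.zero_apply, mul_zero])

/-- The subspace of `A^*` of all functionals satisfying the `Q(z)`-compatibility condition. -/
def TQ (z : ℂ) : Submodule ℂ (Module.Dual ℂ A) where
  carrier := {f | 𝒜.QCompatible z f}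
  zero_mem' :=
    ⟨fun v => ⟨0, fun p _ => map_zero _⟩, fun v a p q => by
      simp [deltaCoeff, firstTerm, secondTerm]⟩
  add_mem' {f g} hf hg := by
    refine ⟨fun v => ?_, fun v a p q => ?_⟩
    · obtain ⟨N₁, h₁⟩ := hf.lower_truncation v
      obtain ⟨N₂, h₂⟩ := hg.lower_truncation v
      exact ⟨max N₁ N₂, fun p hp => by
        rw [map_add, h₁ p (le_trans (le_max_left _ _) hp),
          h₂ p (le_trans (le_max_right _ _) hp), add_zero]⟩
    · rw [deltaCoeff_add_functional, ← hf.jacobi, ← hg.jacobi,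
        ← finsum_add_distrib (𝒜.left_finite hf.lower_truncation ..)
          (𝒜.left_finite hg.lower_truncation ..)]
      simp only [map_add, LinearMap.add_apply, mul_add]
  smul_mem' c f hf := by
    refine ⟨fun v => ?_, fun v a p q => ?_⟩
    · obtain ⟨N, h⟩ := hf.lower_truncation v
      exact ⟨N, fun p hp => by rw [map_smul, h p hp, smul_zero]⟩
    · rw [deltaCoeff_smul_functional, ← hf.jacobi,
        mul_finsum' _ _ (𝒜.left_finite hf.lower_truncation ..)]
      simp only [map_smul, LinearMap.smul_apply, smul_eq_mul, mul_left_comm _ c]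

end WeakModule

end

/-! ### Binomial sums -/

namespace FormalCalculus

open Filter

section Truncation

variable {M : Type*} [Zero M]

/-! Write P for the opposite of `Y₁` and Q for `Y₂`. P(v, x)a has bounded above powers of x and
satisfies the Jacobi identity with all products reversed (`opposite_jacobi`); Q(v, x)a has powers
bounded below and satisfies the ordinary identity; modes of P commute with modes of Q
(`Y₁_Y₂_commute`). For a functional f, `gap` is the pairing of ⟨f, P(v, x)a⟩ with (x - z)^p x^q
expanded at infinity, minus the pairing of ⟨f, Q(v, x)a⟩ with the same function expanded at 0. The
modes of Y'_{Q(z)} are the gaps with q = 0 (`YQ_eq_dualMode`).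

Compatibility of f is equivalent to locality (`qCompatible_iff`): for large k, (x - z)^k kills ⟨f,
P(v, x)a⟩ - ⟨f, Q(v, x)a⟩, uniformly in a. Thus both series expand one rational function with poles
only at 0, z and infinity, and Y'_{Q(z)}(v, x₀)f is its expansion at z. The theorem is then residue
calculus.

Stability: moving modes of v past modes of u writes the gap of a transformed functional through gaps
of f (`gap_dualMode`), so locality survives (`IsLocal.dualMode`). Jacobi identity: with yᵢ = xᵢ - z,
a product of two dual modes splits into terms PP, PQ, QP, QQ weighted by (y₁ - y₂)^l.
`altSum_translate` and `altSum_reverse` turn these into expansions of (x₁ - x₂)^l in the proper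
domains (`altSum_dualMode`). The mixed terms cancel in the Jacobi combination, leaving the identity
of P minus that of Q, both first extended to allow powers of x - z (`jacobi_extend`).

Equality of two expansions is always proved by uniqueness: both sides obey one recurrence, agree at
exponent zero and vanish at the same end. The Jacobi identity for P rests on the conjugation of
modes by exp(xL(1)) (`expL_mode`). -/

theorem eventually_sub {r : ℤ → M} (hr : ∀ᶠ n in atBot, r n = 0) (s : ℤ) :
    ∀ᶠ i : ℕ in atTop, r (s - i) = 0 := by
  obtain ⟨K, hK⟩ := eventually_atBot.1 hr
  exact eventually_atTop.2 ⟨(s - K).toNat, fun i hi => hK _ (by omega)⟩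

theorem eventually_add {r : ℤ → M} (hr : ∀ᶠ n in atTop, r n = 0) (s : ℤ) :
    ∀ᶠ i : ℕ in atTop, r (s + i) = 0 := by
  obtain ⟨K, hK⟩ := eventually_atTop.1 hr
  exact eventually_atTop.2 ⟨(K - s).toNat, fun i hi => hK _ (by omega)⟩

end Truncation

section BinomialSums

variable {M N : Type*} [AddCommGroup M] [Module ℂ M] [AddCommGroup N] [Module ℂ N]

/-- `∑ᵢ C(m, i) φᵢ`. -/
noncomputable def binomSum (m : ℤ) (φ : ℕ → M) : M :=
  ∑ᶠ i : ℕ, ((Ring.choose m i : ℤ) : ℂ) • φ i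

theorem binomSum_eq_sum_range (m : ℤ) {φ : ℕ → M} {K : ℕ} (h : ∀ i, K ≤ i → φ i = 0) :
    binomSum m φ = ∑ i ∈ Finset.range K, ((Ring.choose m i : ℤ) : ℂ) • φ i := by
  refine finsum_eq_sum_of_support_subset _ fun i hi => ?_
  by_contra hK
  refine hi ?_
  simp only [Finset.coe_range, Set.mem_Iio, not_lt] at hK
  simp only [h i hK, smul_zero]

/-- Eventual vanishing is essential here and below: `finsum` takes the value 0 on infinite support,
so it is not additive without it. -/
theorem binomSum_add (m : ℤ) {φ ψ : ℕ → M} (hφ : ∀ᶠ i in atTop, φ i = 0)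
    (hψ : ∀ᶠ i in atTop, ψ i = 0) :
    binomSum m (fun i => φ i + ψ i) = binomSum m φ + binomSum m ψ := by
  obtain ⟨K, hK⟩ := eventually_atTop.1 (hφ.and hψ)
  rw [binomSum_eq_sum_range m (K := K) fun i hi => by rw [(hK i hi).1, (hK i hi).2, add_zero],
    binomSum_eq_sum_range m fun i hi => (hK i hi).1,
    binomSum_eq_sum_range m fun i hi => (hK i hi).2, ← Finset.sum_add_distrib]
  simp only [smul_add]

theorem map_binomSum (m : ℤ) {φ : ℕ → M} (hφ : ∀ᶠ i in atTop, φ i = 0) (f : M →ₗ[ℂ] N) :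
    f (binomSum m φ) = binomSum m fun i => f (φ i) := by
  obtain ⟨K, hK⟩ := eventually_atTop.1 hφ
  rw [binomSum_eq_sum_range m hK,
    binomSum_eq_sum_range m (K := K) fun i hi => by rw [hK i hi, map_zero], map_sum]
  simp only [map_smul]

theorem binomSum_smul (m : ℤ) (c : ℂ) {φ : ℕ → M} (hφ : ∀ᶠ i in atTop, φ i = 0) :
    binomSum m (fun i => c • φ i) = c • binomSum m φ :=
  (map_binomSum m hφ (LinearMap.lsmul ℂ M c)).symm

theorem binomSum_neg (m : ℤ) (φ : ℕ → M) :
    binomSum m (fun i => -φ i) = -binomSum m φ := by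
  simp only [binomSum, smul_neg, finsum_neg_distrib]

theorem binomSum_sub (m : ℤ) {φ ψ : ℕ → M} (hφ : ∀ᶠ i in atTop, φ i = 0)
    (hψ : ∀ᶠ i in atTop, ψ i = 0) :
    binomSum m (fun i => φ i - ψ i) = binomSum m φ - binomSum m ψ := by
  simp only [sub_eq_add_neg]
  rw [binomSum_add m hφ (by filter_upwards [hψ] with i hi; rw [hi, neg_zero]), binomSum_neg]

theorem binomSum_sum {ι : Type*} (m : ℤ) (s : Finset ι) {φ : ι → ℕ → M}
    (hφ : ∀ a ∈ s, ∀ᶠ i in atTop, φ a i = 0) :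
    binomSum m (fun i => ∑ a ∈ s, φ a i) = ∑ a ∈ s, binomSum m (φ a) := by
  obtain ⟨K, hK⟩ := eventually_atTop.1 ((eventually_all_finset s).2 hφ)
  rw [binomSum_eq_sum_range m (K := K) fun i hi => Finset.sum_eq_zero (hK i hi),
    Finset.sum_congr rfl fun a ha => binomSum_eq_sum_range m fun i hi => hK i hi a ha,
    Finset.sum_comm]
  simp only [Finset.smul_sum]

theorem binomSum_eq_zero (m : ℤ) {φ : ℕ → M} (h : ∀ i, φ i = 0) : binomSum m φ = 0 := by
  rw [binomSum_eq_sum_range m (K := 0) fun i _ => h i, Finset.sum_range_zero]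

theorem binomSum_zero_left (φ : ℕ → M) : binomSum 0 φ = φ 0 := by
  rw [binomSum, finsum_eq_single _ 0]
  · simp
  · intro i hi
    rw [Ring.choose_zero_pos ℤ (Nat.pos_of_ne_zero hi)]
    simp

/-- Pascal's rule; every recurrence for an expansion comes from it. -/
theorem binomSum_succ (m : ℤ) {φ : ℕ → M} (hφ : ∀ᶠ i in atTop, φ i = 0) :
    binomSum (m + 1) φ = binomSum m φ + binomSum m fun i => φ (i + 1) := by
  obtain ⟨K, hK⟩ := eventually_atTop.1 hφ
  rw [binomSum_eq_sum_range (m + 1) (K := K + 1) fun i hi => hK i (by omega),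
    binomSum_eq_sum_range m (K := K + 1) fun i hi => hK i (by omega),
    binomSum_eq_sum_range m (K := K) fun i hi => hK (i + 1) (by omega),
    Finset.sum_range_succ', Finset.sum_range_succ']
  simp only [Ring.choose_succ_succ, Int.cast_add, add_smul, Finset.sum_add_distrib,
    Ring.choose_zero_right]
  abel

/-- `∑ᵢ (-1)ⁱ C(l, i) φᵢ`. -/
noncomputable def altSum (l : ℤ) (φ : ℕ → M) : M := binomSum l fun i => (-1 : ℂ) ^ i • φ i

theorem eventually_smul {φ : ℕ → M} (c : ℕ → ℂ) (hφ : ∀ᶠ i in atTop, φ i = 0) :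
    ∀ᶠ i in atTop, c i • φ i = 0 := by
  filter_upwards [hφ] with i hi
  rw [hi, smul_zero]

theorem altSum_eq_finsum (l : ℤ) (φ : ℕ → M) :
    altSum l φ = ∑ᶠ i : ℕ, ((-1 : ℂ) ^ i * (Ring.choose l i : ℤ)) • φ i := by
  simp only [altSum, binomSum, smul_smul, mul_comm]

theorem altSum_add (l : ℤ) {φ ψ : ℕ → M} (hφ : ∀ᶠ i in atTop, φ i = 0)
    (hψ : ∀ᶠ i in atTop, ψ i = 0) :
    altSum l (fun i => φ i + ψ i) = altSum l φ + altSum l ψ := by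
  simp only [altSum, smul_add]
  exact binomSum_add l (eventually_smul _ hφ) (eventually_smul _ hψ)

theorem altSum_sub (l : ℤ) {φ ψ : ℕ → M} (hφ : ∀ᶠ i in atTop, φ i = 0)
    (hψ : ∀ᶠ i in atTop, ψ i = 0) :
    altSum l (fun i => φ i - ψ i) = altSum l φ - altSum l ψ := by
  simp only [altSum, smul_sub]
  exact binomSum_sub l (eventually_smul _ hφ) (eventually_smul _ hψ)

theorem map_altSum (l : ℤ) {φ : ℕ → M} (hφ : ∀ᶠ i in atTop, φ i = 0) (f : M →ₗ[ℂ] N) :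
    f (altSum l φ) = altSum l fun i => f (φ i) := by
  simp only [altSum, map_binomSum l (eventually_smul _ hφ) f, map_smul]

theorem altSum_smul (l : ℤ) (c : ℂ) {φ : ℕ → M} (hφ : ∀ᶠ i in atTop, φ i = 0) :
    altSum l (fun i => c • φ i) = c • altSum l φ :=
  (map_altSum l hφ (LinearMap.lsmul ℂ M c)).symm

theorem altSum_sum {ι : Type*} (l : ℤ) (s : Finset ι) {φ : ι → ℕ → M}
    (hφ : ∀ a ∈ s, ∀ᶠ i in atTop, φ a i = 0) :
    altSum l (fun i => ∑ a ∈ s, φ a i) = ∑ a ∈ s, altSum l (φ a) := by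
  simp only [altSum, Finset.smul_sum]
  exact binomSum_sum l s fun a ha => eventually_smul _ (hφ a ha)

theorem altSum_eq_zero (l : ℤ) {φ : ℕ → M} (h : ∀ i, φ i = 0) : altSum l φ = 0 :=
  binomSum_eq_zero l fun i => by rw [h, smul_zero]

theorem altSum_zero_left (φ : ℕ → M) : altSum 0 φ = φ 0 := by
  rw [altSum, binomSum_zero_left, pow_zero, one_smul]

theorem altSum_succ (l : ℤ) {φ : ℕ → M} (hφ : ∀ᶠ i in atTop, φ i = 0) :
    altSum (l + 1) φ = altSum l φ - altSum l fun i => φ (i + 1) := by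
  rw [altSum, binomSum_succ l (eventually_smul _ hφ), sub_eq_add_neg]
  simp only [altSum, ← binomSum_neg, ← neg_smul]
  simp only [pow_succ, mul_neg_one]

end BinomialSums

/-! ### Families of coefficients determined by their recurrences -/

section Recurrences

variable {M : Type*} [AddCommGroup M]

section Shift

variable [Module ℂ M]

/-- The recurrence satisfied by the coefficients `X p q` of a series paired with
`(x - z)^p x^q`. -/
def IsShift (z : ℂ) (X : ℤ → ℤ → M) : Prop :=
  ∀ p q, X (p + 1) q = X p (q + 1) - z • X p q

theorem IsShift.sub {z : ℂ} {X Y : ℤ → ℤ → M} (hX : IsShift z X) (hY : IsShift z Y) :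
    IsShift z fun p q => X p q - Y p q := fun p q => by
  simp only [hX p q, hY p q, smul_sub]
  abel

theorem IsShift.map {N : Type*} [AddCommGroup N] [Module ℂ N] {z : ℂ} {X : ℤ → ℤ → M}
    (hX : IsShift z X) (f : M →ₗ[ℂ] N) : IsShift z fun p q => f (X p q) := fun p q => by
  simp only [hX p q, map_sub, map_smul]

/-- Vanishing at low q selects the expansion of (x - z)^p at infinity. For p ≥ 0 the recurrence
computes row p from row 0. For p < 0, once row p + 1 is zero, it reads X p (q + 1) = z X p q and
carries zeros upward from a low q. -/
theorem IsShift.eq_zero_of_atBot {z : ℂ} {X : ℤ → ℤ → M} (hX : IsShift z X)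
    (h₀ : ∀ q, X 0 q = 0) (hb : ∀ p, ∀ᶠ q in atBot, X p q = 0) (p q : ℤ) : X p q = 0 := by
  induction p using Int.induction_on generalizing q with
  | zero => exact h₀ q
  | succ p ih => rw [hX, ih, ih, smul_zero, sub_zero]
  | pred p ih =>
    obtain ⟨K, hK⟩ := eventually_atBot.1 (hb (-p - 1))
    rcases le_total q K with hq | hq
    · exact hK q hq
    · induction q, hq using Int.leInduction with
      | base => exact hK K le_rfl
      | succ q _ ihq =>
        have h := hX (-p - 1) q
        rw [ihq, sub_add_cancel, ih, smul_zero, sub_zero] at h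
        exact h.symm

/-- Vanishing at high q selects the expansion at 0. For negative p the zeros travel downward in q,
which requires division by z. -/
theorem IsShift.eq_zero_of_atTop {z : ℂ} (hz : z ≠ 0) {X : ℤ → ℤ → M} (hX : IsShift z X)
    (h₀ : ∀ q, X 0 q = 0) (hb : ∀ p, ∀ᶠ q in atTop, X p q = 0) (p q : ℤ) : X p q = 0 := by
  induction p using Int.induction_on generalizing q with
  | zero => exact h₀ q
  | succ p ih => rw [hX, ih, ih, smul_zero, sub_zero]
  | pred p ih =>
    obtain ⟨K, hK⟩ := eventually_atTop.1 (hb (-p - 1))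
    rcases le_total K q with hq | hq
    · exact hK q hq
    · induction q, hq using Int.leInductionDown with
      | base => exact hK K le_rfl
      | pred q _ ihq =>
        have h := hX (-p - 1) (q - 1)
        rw [sub_add_cancel, sub_add_cancel, ihq, ih, zero_sub, eq_comm, neg_eq_zero] at h
        exact (smul_eq_zero.1 h).resolve_left hz

/-- As `IsShift.eq_zero_of_atTop`, with the roles of the exponents exchanged. -/
theorem IsShift.eq_zero_of_right {z : ℂ} (hz : z ≠ 0) {X : ℤ → ℤ → M} (hX : IsShift z X)
    (h₀ : ∀ p, X p 0 = 0) (hb : ∀ q, ∀ᶠ p in atTop, X p q = 0) (p q : ℤ) : X p q = 0 := by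
  -- In the variable y = x - z one has x = y - (-z), so transposing a family replaces z by -z, and
  -- the expansion at y = 0 is the one at x = z.
  have h : IsShift (-z) fun q p => X p q := fun q p => by
    simp only [hX p q, neg_smul]
    abel
  exact h.eq_zero_of_atTop (neg_ne_zero.2 hz) h₀ hb q p

end Shift

/-- The recurrence satisfied by the coefficients `X l m n` of a series paired with
`(x₁ - x₂)^l x₁^m x₂^n`. -/
def IsDifference (X : ℤ → ℤ → ℤ → M) : Prop :=
  ∀ l m n, X (l + 1) m n = X l (m + 1) n - X l m (n + 1)

theorem IsDifference.sub {X Y : ℤ → ℤ → ℤ → M} (hX : IsDifference X) (hY : IsDifference Y) :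
    IsDifference fun l m n => X l m n - Y l m n := fun l m n => by
  simp only [hX l m n, hY l m n]
  abel

/-- For negative l the recurrence becomes X l (m + 1) n = X l m (n + 1) once level l + 1 is zero.
Each step in m also moves n, hence the bound in m must be uniform in n. -/
theorem IsDifference.eq_zero_of_atBot {X : ℤ → ℤ → ℤ → M} (hX : IsDifference X)
    (h₀ : ∀ m n, X 0 m n = 0) (hb : ∀ l, ∀ᶠ m in atBot, ∀ n, X l m n = 0) (l m n : ℤ) :
    X l m n = 0 := by
  induction l using Int.induction_on generalizing m n with
  | zero => exact h₀ m n
  | succ p ih => rw [hX, ih, ih, sub_zero]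
  | pred p ih =>
    obtain ⟨K, hK⟩ := eventually_atBot.1 (hb (-p - 1))
    rcases le_total m K with hm | hm
    · exact hK m hm n
    · induction m, hm using Int.leInduction generalizing n with
      | base => exact hK K le_rfl n
      | succ m _ ihm =>
        have h := hX (-p - 1) m n
        rw [ihm, sub_add_cancel, ih, sub_zero] at h
        exact h.symm

theorem IsDifference.eq_zero_of_atTop {X : ℤ → ℤ → ℤ → M} (hX : IsDifference X)
    (h₀ : ∀ m n, X 0 m n = 0) (hb : ∀ l, ∀ᶠ m in atTop, ∀ n, X l m n = 0) (l m n : ℤ) :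
    X l m n = 0 := by
  induction l using Int.induction_on generalizing m n with
  | zero => exact h₀ m n
  | succ p ih => rw [hX, ih, ih, sub_zero]
  | pred p ih =>
    obtain ⟨K, hK⟩ := eventually_atTop.1 (hb (-p - 1))
    rcases le_total K m with hm | hm
    · exact hK m hm n
    · induction m, hm using Int.leInductionDown generalizing n with
      | base => exact hK K le_rfl n
      | pred m _ ihm =>
        have h := hX (-p - 1) (m - 1) (n - 1)
        rw [sub_add_cancel, sub_add_cancel, sub_add_cancel, ihm, ih, zero_sub, eq_comm,
          neg_eq_zero] at h
        exact h

end Recurrences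

/-! ### Expansions of `(x - z)^p x^q` -/

section Expansions

variable {M N : Type*} [AddCommGroup M] [Module ℂ M] [AddCommGroup N] [Module ℂ N]

/-- The pairing of `∑ₙ rₙ x^{-n-1}` with the expansion of `(x - z)^p x^q` at `∞`. -/
noncomputable def atInfinity (z : ℂ) (r : ℤ → M) (p q : ℤ) : M :=
  binomSum p fun i => (-z) ^ i • r (p + q - i)

/-- The pairing of `∑ₙ rₙ x^{-n-1}` with the expansion of `(x - z)^p x^q` at `0`. -/
noncomputable def atOrigin (z : ℂ) (r : ℤ → M) (p q : ℤ) : M :=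
  (-1 : ℂ) ^ p • binomSum p fun i => ((-1 : ℂ) ^ i * z ^ (p - i)) • r (q + i)

theorem atInfinity_zero_left (z : ℂ) (r : ℤ → M) (q : ℤ) : atInfinity z r 0 q = r q := by
  rw [atInfinity, binomSum_zero_left]
  simp

theorem atOrigin_zero_left (z : ℂ) (r : ℤ → M) (q : ℤ) : atOrigin z r 0 q = r q := by
  rw [atOrigin, binomSum_zero_left]
  simp

theorem atInfinity_isShift (z : ℂ) {r : ℤ → M} (hr : ∀ᶠ n in atBot, r n = 0) :
    IsShift z (atInfinity z r) := fun p q => by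
  rw [atInfinity, binomSum_succ _ (eventually_smul _ (eventually_sub hr _)), sub_eq_add_neg]
  congr 1
  · simp only [atInfinity, add_right_comm p 1 q, add_assoc p q 1]
  · rw [atInfinity, ← neg_smul, ← binomSum_smul _ _ (eventually_smul _ (eventually_sub hr _))]
    congr 1
    funext i
    rw [smul_smul, ← pow_succ']
    congr 2
    push_cast
    ring

/-- Of the two sums from Pascal's rule, the shifted one supplies the factor x and the unshifted one
the factor -z, the reverse of the situation at infinity. The exponents of z may be negative, hence z
≠ 0. -/
theorem atOrigin_isShift {z : ℂ} (hz : z ≠ 0) {r : ℤ → M} (hr : ∀ᶠ n in atTop, r n = 0) :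
    IsShift z (atOrigin z r) := fun p q => by
  rw [atOrigin, binomSum_succ _ (eventually_smul _ (eventually_add hr _)), smul_add, add_comm,
    sub_eq_add_neg]
  congr 1
  · rw [atOrigin, zpow_add_one₀ (by norm_num), mul_smul, neg_one_smul, ← binomSum_neg]
    congr 2
    funext i
    rw [← neg_smul]
    congr 1
    · rw [show p + 1 - ((i + 1 : ℕ) : ℤ) = p - i by push_cast; ring, pow_succ]
      ring
    · congr 1
      push_cast
      ring
  · rw [atOrigin, zpow_add_one₀ (by norm_num), mul_smul, neg_one_smul, smul_comm z, ← smul_neg,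
      ← binomSum_smul _ _ (eventually_smul _ (eventually_add hr _))]
    congr 3
    funext i
    rw [smul_smul, show p + 1 - (i : ℤ) = p - i + 1 by ring, zpow_add_one₀ hz]
    congr 1
    ring

theorem atInfinity_eq_zero (z : ℂ) {r : ℤ → M} {K : ℤ} (hK : ∀ n ≤ K, r n = 0) {p q : ℤ}
    (h : p + q ≤ K) : atInfinity z r p q = 0 :=
  binomSum_eq_zero p fun i => by rw [hK _ (by omega), smul_zero]

theorem atOrigin_eq_zero (z : ℂ) {r : ℤ → M} {K : ℤ} (hK : ∀ n ≥ K, r n = 0) {p q : ℤ}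
    (h : K ≤ q) : atOrigin z r p q = 0 := by
  rw [atOrigin, binomSum_eq_zero p fun i => by rw [hK _ (by omega), smul_zero], smul_zero]

theorem map_atInfinity (z : ℂ) {r : ℤ → M} (hr : ∀ᶠ n in atBot, r n = 0) (f : M →ₗ[ℂ] N)
    (p q : ℤ) : f (atInfinity z r p q) = atInfinity z (fun n => f (r n)) p q := by
  simp only [atInfinity, map_binomSum _ (eventually_smul _ (eventually_sub hr _)), map_smul]

theorem map_atOrigin (z : ℂ) {r : ℤ → M} (hr : ∀ᶠ n in atTop, r n = 0) (f : M →ₗ[ℂ] N)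
    (p q : ℤ) : f (atOrigin z r p q) = atOrigin z (fun n => f (r n)) p q := by
  simp only [atOrigin, map_smul, map_binomSum _ (eventually_smul _ (eventually_add hr _))]

end Expansions

/-! ### Changes of variables in `(x₁ - x₂)^l` -/

section TwoVariables

variable {M : Type*} [AddCommGroup M] [Module ℂ M]

/-- With `yᵢ = xᵢ - z`, the expansions of `(y₁ - y₂)^l` and of `(x₁ - x₂)^l` in nonnegative powers
of the second variable agree. Here `Φ m p n q` pairs with `y₁^m x₁^p y₂^n x₂^q`. -/
theorem altSum_translate {z : ℂ} {Φ : ℤ → ℤ → ℤ → ℤ → M}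
    (h₁ : ∀ n q, IsShift z fun m p => Φ m p n q) (h₂ : ∀ m p, IsShift z (Φ m p))
    {K : ℤ} (hK : ∀ m p n q, m + p ≤ K → Φ m p n q = 0) (l m n : ℤ) :
    altSum l (fun i => Φ (l + m - i) 0 (n + i) 0) = altSum l fun i => Φ m (l - i) n i := by
  have ev₁ : ∀ l m n : ℤ, ∀ᶠ i : ℕ in atTop, Φ (l + m - i) 0 (n + i) 0 = 0 := fun l m n =>
    eventually_atTop.2 ⟨(l + m - K).toNat, fun i hi => hK _ _ _ _ (by omega)⟩
  have ev₂ : ∀ l m n s t : ℤ, ∀ᶠ i : ℕ in atTop, Φ m (l - i + s) n (i + t) = 0 :=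
    fun l m n s t => eventually_atTop.2 ⟨(l + m + s - K).toNat, fun i hi => hK _ _ _ _ (by omega)⟩
  have ev₃ : ∀ l m n : ℤ, ∀ᶠ i : ℕ in atTop, Φ m (l - i) n i = 0 := by
    simpa using fun l m n => ev₂ l m n 0 0
  have hX : IsDifference fun l m n => altSum l fun i => Φ (l + m - i) 0 (n + i) 0 :=
    fun l m n => by
      simp only
      rw [altSum_succ _ (ev₁ _ _ _)]
      congr 2
      · funext i
        rw [add_right_comm, add_assoc]
      · funext i
        congr 1 <;> push_cast <;> ring
  have hY : IsDifference fun l m n => altSum l fun i => Φ m (l - i) n i := fun l m n => by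
    simp only
    rw [altSum_succ _ (ev₃ _ _ _)]
    -- Raising m and raising n produce the same term in z, which cancels in the difference: y₁ - y₂
    -- = x₁ - x₂.
    have e₁ : ∀ i : ℕ, Φ (m + 1) (l - i) n i = Φ m (l - i + 1) n i - z • Φ m (l - i) n i :=
      fun i => h₁ n i m (l - i)
    have e₂ : ∀ i : ℕ, Φ m (l - i) (n + 1) i = Φ m (l - i) n (i + 1) - z • Φ m (l - i) n i :=
      fun i => h₂ m (l - i) n i
    simp only [e₁, e₂]
    rw [altSum_sub _ (by simpa using ev₂ l m n 1 0) (eventually_smul (fun _ => z) (ev₃ l m n)),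
      altSum_sub _ (by simpa using ev₂ l m n 0 1) (eventually_smul (fun _ => z) (ev₃ l m n)),
      sub_sub_sub_cancel_right]
    congr 2
    · funext i
      congr 1
      ring
    · funext i
      congr 1
      push_cast
      ring
  refine sub_eq_zero.1 ((hX.sub hY).eq_zero_of_atBot (fun m n => ?_) (fun l => ?_) l m n)
  · rw [altSum_zero_left, altSum_zero_left]
    simp
  -- On both sides the first variable has total degree l + m - i, so m ≤ K - l puts every term under
  -- the bound K, whatever n is.
  · refine eventually_atBot.2 ⟨K - l, fun m hm n => ?_⟩
    rw [altSum_eq_zero l fun i => hK _ _ _ _ (by omega),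
      altSum_eq_zero l fun i => hK _ _ _ _ (by omega), sub_zero]

/-- Near `x₁ = z`, `x₂ = 0` the expansions of `(x₁ - x₂)^l` and of `(-1)^l (y₂ - y₁)^l` agree. -/
theorem altSum_reverse {z : ℂ} {Ψ : ℤ → ℤ → ℤ → ℤ → M}
    (h₁ : ∀ n q, IsShift z fun m p => Ψ m p n q) (h₂ : ∀ m p, IsShift z (Ψ m p))
    {K : ℤ} (hK : ∀ m p n q, K ≤ m → Ψ m p n q = 0)
    (hK' : ∀ n, ∀ᶠ q in atTop, ∀ m p, Ψ m p n q = 0) (l m n : ℤ) :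
    altSum l (fun i => Ψ m (l - i) n i) =
      (-1 : ℂ) ^ l • altSum l fun i => Ψ (m + i) 0 (l + n - i) 0 := by
  have ev₁ : ∀ l m n : ℤ, ∀ᶠ i : ℕ in atTop, Ψ (m + i) 0 (l + n - i) 0 = 0 := fun l m n =>
    eventually_atTop.2 ⟨(K - m).toNat, fun i hi => hK _ _ _ _ (by omega)⟩
  have ev₂ : ∀ l m n s t : ℤ, ∀ᶠ i : ℕ in atTop, Ψ m (l - i + s) n (i + t) = 0 :=
    fun l m n s t => by
      obtain ⟨Q, hQ⟩ := eventually_atTop.1 (hK' n)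
      exact eventually_atTop.2 ⟨(Q - t).toNat, fun i hi => hQ _ (by omega) _ _⟩
  have ev₃ : ∀ l m n : ℤ, ∀ᶠ i : ℕ in atTop, Ψ m (l - i) n i = 0 := by
    simpa using fun l m n => ev₂ l m n 0 0
  have hX : IsDifference fun l m n =>
      (-1 : ℂ) ^ l • altSum l fun i => Ψ (m + i) 0 (l + n - i) 0 :=
    fun l m n => by
      simp only
      rw [altSum_succ _ (ev₁ _ _ _), zpow_add_one₀ (by norm_num), mul_smul, neg_one_smul, neg_sub,
        smul_sub]
      congr 3
      · funext i
        congr 1 <;> push_cast <;> ring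
      · funext i
        congr 1
        ring
  have hY : IsDifference fun l m n => altSum l fun i => Ψ m (l - i) n i := fun l m n => by
    simp only
    rw [altSum_succ _ (ev₃ _ _ _)]
    have e₁ : ∀ i : ℕ, Ψ (m + 1) (l - i) n i = Ψ m (l - i + 1) n i - z • Ψ m (l - i) n i :=
      fun i => h₁ n i m (l - i)
    have e₂ : ∀ i : ℕ, Ψ m (l - i) (n + 1) i = Ψ m (l - i) n (i + 1) - z • Ψ m (l - i) n i :=
      fun i => h₂ m (l - i) n i
    simp only [e₁, e₂]
    rw [altSum_sub _ (by simpa using ev₂ l m n 1 0) (eventually_smul (fun _ => z) (ev₃ l m n)),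
      altSum_sub _ (by simpa using ev₂ l m n 0 1) (eventually_smul (fun _ => z) (ev₃ l m n)),
      sub_sub_sub_cancel_right]
    congr 2
    · funext i
      congr 1
      ring
    · funext i
      congr 1
      push_cast
      ring
  refine sub_eq_zero.1 ((hY.sub hX).eq_zero_of_atTop (fun m n => ?_) (fun l => ?_) l m n)
  · rw [altSum_zero_left, altSum_zero_left]
    simp
  -- The exponent of y₁ is m on one side and m + i on the other, so both vanish as soon as m ≥ K.
  · refine eventually_atTop.2 ⟨K, fun m hm n => ?_⟩
    rw [altSum_eq_zero l fun i => hK _ _ _ _ (by omega),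
      altSum_eq_zero l fun i => hK _ _ _ _ (by omega), smul_zero, sub_zero]

end TwoVariables

end FormalCalculus

/-! ### Jacobi identities extended to powers of x - z -/

namespace FormalCalculus

open Filter

section Bracket

variable {M : Type*} [AddCommGroup M] [Module ℂ M]

/-- Finiteness conditions on a family `Φ m p n q` of coefficients, paired with
`y₁^m x₁^p y₂^n x₂^q`, under which `(x₁ - x₂)^l` may be expanded in nonnegative powers of `x₂`. -/
structure Admissible (F : Filter ℤ) (Φ : ℤ → ℤ → ℤ → ℤ → M) : Prop where
  finite : ∀ m p n q, ∀ᶠ i : ℕ in atTop, Φ m (p - i) n (q + i) = 0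
  left : ∀ m n q, ∀ᶠ p in F, ∀ i : ℕ, Φ m (p - i) n (q + i) = 0
  right : ∀ m p n, ∀ᶠ q in F, ∀ i : ℕ, Φ m (p - i) n (q + i) = 0

/-- The pairing of `Φ` with `y₁^m x₁^p y₂^n x₂^q (x₁ - x₂)^l`. -/
noncomputable def expandFirst (l : ℤ) (Φ : ℤ → ℤ → ℤ → ℤ → M) (m p n q : ℤ) : M :=
  altSum l fun i => Φ m (l + p - i) n (q + i)

theorem expandFirst_isShift_left {F : Filter ℤ} {z : ℂ} {Φ : ℤ → ℤ → ℤ → ℤ → M}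
    (hΦ : Admissible F Φ) (h : ∀ n q, IsShift z fun m p => Φ m p n q) (l n q : ℤ) :
    IsShift z fun m p => expandFirst l Φ m p n q := fun m p => by
  simp only [expandFirst]
  rw [← altSum_smul _ _ (hΦ.finite _ _ _ _), ← altSum_sub _ (hΦ.finite _ _ _ _)
    (eventually_smul (fun _ => z) (hΦ.finite _ _ _ _))]
  congr 1
  funext i
  rw [show l + (p + 1) - (i : ℤ) = l + p - i + 1 by ring]
  exact h n (q + i) m _

theorem expandFirst_isShift_right {F : Filter ℤ} {z : ℂ} {Φ : ℤ → ℤ → ℤ → ℤ → M}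
    (hΦ : Admissible F Φ) (h : ∀ m p, IsShift z (Φ m p)) (l m p : ℤ) :
    IsShift z (expandFirst l Φ m p) := fun n q => by
  simp only [expandFirst]
  rw [← altSum_smul _ _ (hΦ.finite _ _ _ _), ← altSum_sub _ (hΦ.finite _ _ _ _)
    (eventually_smul (fun _ => z) (hΦ.finite _ _ _ _))]
  congr 1
  funext i
  rw [show q + 1 + (i : ℤ) = q + i + 1 by ring]
  exact h m _ n (q + i)

theorem expandFirst_left {F : Filter ℤ} (hF : ∀ c : ℤ, Tendsto (fun x => c + x) F F)
    {Φ : ℤ → ℤ → ℤ → ℤ → M} (hΦ : Admissible F Φ) (l m n q : ℤ) :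
    ∀ᶠ p in F, expandFirst l Φ m p n q = 0 := by
  filter_upwards [(hF l).eventually (hΦ.left m n q)] with p hp
  exact altSum_eq_zero l hp

theorem expandFirst_right {F : Filter ℤ} {Φ : ℤ → ℤ → ℤ → ℤ → M} (hΦ : Admissible F Φ)
    (l m p n : ℤ) : ∀ᶠ q in F, expandFirst l Φ m p n q = 0 := by
  filter_upwards [hΦ.right m (l + p) n] with q hq
  exact altSum_eq_zero l hq

/-- The pairing of `∑ₛ Wₛ x₀^{-s-1}` with `x₀^l y₁^m x₁^p y₂^n x₂^q`, where `x₁ = x₂ + x₀` is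
expanded in nonnegative powers of `x₀`. -/
noncomputable def iterate (W : ℤ → ℤ → ℤ → M) (l m p n q : ℤ) : M :=
  binomSum m fun j => binomSum p fun k => W (l + j + k) (m + n - j) (p + q - k)

section Iterate

variable {z : ℂ} {W : ℤ → ℤ → ℤ → M} (hW : ∀ᶠ s in atTop, ∀ p q, W s p q = 0)
include hW

omit [Module ℂ M] in
theorem iterate_finite_right (l : ℤ) (j : ℕ) (p : ℤ) (q : ℕ → ℤ) :
    ∀ᶠ k : ℕ in atTop, W (l + j + k) p (q k) = 0 := by
  obtain ⟨K, hK⟩ := eventually_atTop.1 hW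
  exact eventually_atTop.2 ⟨(K - l).toNat, fun k hk => hK _ (by omega) _ _⟩

theorem iterate_finite_left (l p : ℤ) (m : ℕ → ℤ) (q : ℕ → ℤ) :
    ∀ᶠ j : ℕ in atTop, (binomSum p fun k => W (l + j + k) (m j) (q k)) = 0 := by
  obtain ⟨K, hK⟩ := eventually_atTop.1 hW
  exact eventually_atTop.2 ⟨(K - l).toNat, fun j hj =>
    binomSum_eq_zero p fun k => hK _ (by omega) _ _⟩

theorem iterate_isShift_right (hs : ∀ s, IsShift z (W s)) (l m p : ℤ) :
    IsShift z (iterate W l m p) := fun n q => by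
  simp only [iterate]
  rw [← binomSum_smul _ _ (iterate_finite_left hW ..), ← binomSum_sub _
    (iterate_finite_left hW ..) (eventually_smul (fun _ => z) (iterate_finite_left hW ..))]
  congr 1
  funext j
  rw [← binomSum_smul _ _ (iterate_finite_right hW ..), ← binomSum_sub _
    (iterate_finite_right hW ..) (eventually_smul (fun _ => z) (iterate_finite_right hW ..))]
  congr 1
  funext k
  rw [show m + (n + 1) - (j : ℤ) = m + n - j + 1 by ring,
    show p + (q + 1) - (k : ℤ) = p + q - k + 1 by ring]
  exact hs _ _ _

/-- Pascal's rule in m and in p yields the same extra sum, with s raised by one: it comes from the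
common x₀ in y₁ = y₂ + x₀ and x₁ = x₂ + x₀. It cancels, and what remains is the recurrence of W. -/
theorem iterate_isShift_left (hs : ∀ s, IsShift z (W s)) (l n q : ℤ) :
    IsShift z fun m p => iterate W l m p n q := fun m p => by
  have e₁ : iterate W l (m + 1) p n q =
      (binomSum m fun j => binomSum p fun k => W (l + j + k) (m + n - j + 1) (p + q - k)) +
        binomSum m fun j => binomSum p fun k => W (l + j + k + 1) (m + n - j) (p + q - k) := by
    rw [iterate, binomSum_succ _ (iterate_finite_left hW ..)]
    congr 2
    · funext j
      simp only [show m + 1 + n - (j : ℤ) = m + n - j + 1 by ring]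
    · funext j
      congr 1
      funext k
      congr 1 <;> push_cast <;> ring
  have e₂ : iterate W l m (p + 1) n q =
      (binomSum m fun j => binomSum p fun k => W (l + j + k) (m + n - j) (p + q - k + 1)) +
        binomSum m fun j => binomSum p fun k => W (l + j + k + 1) (m + n - j) (p + q - k) := by
    rw [← binomSum_add _ (iterate_finite_left hW ..)]
    · rw [iterate]
      congr 1
      funext j
      rw [binomSum_succ _ (iterate_finite_right hW ..)]
      congr 2
      · funext k
        congr 1
        ring
      · funext k
        congr 1 <;> push_cast <;> ring
    · have := iterate_finite_left hW (l + 1) p (fun j => m + n - j) (fun k => p + q - k)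
      filter_upwards [this] with j hj
      rw [← hj]
      congr 1
      funext k
      congr 1
      ring
  simp only [e₁, e₂]
  rw [add_sub_right_comm]
  congr 1
  rw [iterate, ← binomSum_smul _ _ (iterate_finite_left hW ..), ← binomSum_sub _
    (iterate_finite_left hW ..) (eventually_smul (fun _ => z) (iterate_finite_left hW ..))]
  congr 1
  funext j
  rw [← binomSum_smul _ _ (iterate_finite_right hW ..), ← binomSum_sub _
    (iterate_finite_right hW ..) (eventually_smul (fun _ => z) (iterate_finite_right hW ..))]
  congr 1
  funext k
  exact hs _ _ _

-- Since W vanishes for large s, only finitely many pairs (j, k) matter, and finitely many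
-- conditions along F can be imposed at once.
omit [Module ℂ M] in
theorem iterate_eventually {F : Filter ℤ} (hF : ∀ c : ℤ, Tendsto (fun x => c + x) F F)
    (hq : ∀ s p, ∀ᶠ q in F, W s p q = 0) (l m n c : ℤ) :
    ∀ᶠ x in F, ∀ j k : ℕ, W (l + j + k) (m + n - j) (c + x - k) = 0 := by
  obtain ⟨K, hK⟩ := eventually_atTop.1 hW
  have h : ∀ᶠ x in F, ∀ j ∈ Finset.range (K - l).toNat, ∀ k ∈ Finset.range (K - l).toNat,
      W (l + j + k) (m + n - j) (c + x - k) = 0 := by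
    refine (eventually_all_finset _).2 fun j _ => (eventually_all_finset _).2 fun k _ => ?_
    filter_upwards [(hF (c - k)).eventually (hq (l + j + k) (m + n - j))] with x hx
    rw [← hx]
    congr 1
    ring
  filter_upwards [h] with x hx j k
  by_cases hj : j < (K - l).toNat
  · by_cases hk : k < (K - l).toNat
    · exact hx j (Finset.mem_range.2 hj) k (Finset.mem_range.2 hk)
    · exact hK _ (by omega) _ _
  · exact hK _ (by omega) _ _

theorem iterate_right {F : Filter ℤ} (hF : ∀ c : ℤ, Tendsto (fun x => c + x) F F)
    (hq : ∀ s p, ∀ᶠ q in F, W s p q = 0) (l m p n : ℤ) :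
    ∀ᶠ q in F, iterate W l m p n q = 0 := by
  filter_upwards [iterate_eventually hW hF hq l m n p] with q hq
  exact binomSum_eq_zero m fun j => binomSum_eq_zero p fun k => hq j k

theorem iterate_left {F : Filter ℤ} (hF : ∀ c : ℤ, Tendsto (fun x => c + x) F F)
    (hq : ∀ s p, ∀ᶠ q in F, W s p q = 0) (l m n q : ℤ) :
    ∀ᶠ p in F, iterate W l m p n q = 0 := by
  filter_upwards [iterate_eventually hW hF hq l m n q] with p hp
  exact binomSum_eq_zero m fun j => binomSum_eq_zero p fun k => by rw [add_comm p q]; exact hp j k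

end Iterate

/-- A Jacobi identity for the monomials `x₁^p x₂^q` extends to `y₁^m x₁^p y₂^n x₂^q`, where
`yᵢ = xᵢ - z` and all expansions are taken at the point described by the filter `F`. -/
theorem jacobi_extend {F : Filter ℤ} (hF : ∀ c : ℤ, Tendsto (fun x => c + x) F F) {z : ℂ}
    (huniq : ∀ X : ℤ → ℤ → M, IsShift z X → (∀ q, X 0 q = 0) →
      (∀ p, ∀ᶠ q in F, X p q = 0) → ∀ p q, X p q = 0)
    {Φ Φ' : ℤ → ℤ → ℤ → ℤ → M} {W : ℤ → ℤ → ℤ → M}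
    (hΦ : Admissible F Φ) (hΦ' : Admissible F Φ')
    (h₁ : ∀ n q, IsShift z fun m p => Φ m p n q) (h₂ : ∀ m p, IsShift z (Φ m p))
    (h₁' : ∀ n q, IsShift z fun m p => Φ' m p n q) (h₂' : ∀ m p, IsShift z (Φ' m p))
    (hW : ∀ᶠ s in atTop, ∀ p q, W s p q = 0) (hs : ∀ s, IsShift z (W s))
    (hq : ∀ s p, ∀ᶠ q in F, W s p q = 0) (l : ℤ)
    (h : ∀ p q, expandFirst l Φ 0 p 0 q - (-1 : ℂ) ^ l • expandFirst l Φ' 0 q 0 p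
      = iterate W l 0 p 0 q) (m p n q : ℤ) :
    expandFirst l Φ m p n q - (-1 : ℂ) ^ l • expandFirst l Φ' n q m p = iterate W l m p n q := by
  -- The hypothesis is the row n = 0 of a family in (n, q), which `huniq` extends to all n. The
  -- outcome is in turn the row m = 0 of a family in (m, p).
  have hr : ∀ p n q,
      expandFirst l Φ 0 p n q - (-1 : ℂ) ^ l • expandFirst l Φ' n q 0 p = iterate W l 0 p n q := by
    intro p n q
    refine sub_eq_zero.1 (huniq (fun n q => _ - _) (((expandFirst_isShift_right hΦ h₂ l 0 p).sub
      ((expandFirst_isShift_left hΦ' h₁' l 0 p).map (LinearMap.lsmul ℂ M ((-1 : ℂ) ^ l)))).sub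
      (iterate_isShift_right hW hs l 0 p)) (fun q => sub_eq_zero.2 (h p q)) (fun n => ?_) n q)
    filter_upwards [expandFirst_right hΦ l 0 p n, expandFirst_left hF hΦ' l n 0 p,
      iterate_right hW hF hq l 0 p n] with q e₁ e₂ e₃
    simp only [e₁, e₂, e₃, map_zero, sub_zero]
  refine sub_eq_zero.1 (huniq (fun m p => _ - _) (((expandFirst_isShift_left hΦ h₁ l n q).sub
    ((expandFirst_isShift_right hΦ' h₂' l n q).map (LinearMap.lsmul ℂ M ((-1 : ℂ) ^ l)))).sub
    (iterate_isShift_left hW hs l n q)) (fun p => sub_eq_zero.2 (hr p n q)) (fun m => ?_) m p)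
  filter_upwards [expandFirst_left hF hΦ l m n q, expandFirst_right hΦ' l n q m,
    iterate_left hW hF hq l m n q] with q e₁ e₂ e₃
  simp only [e₁, e₂, e₃, map_zero, sub_zero]

end Bracket

end FormalCalculus

/-! ### Commuting opposite pairs and their action on functionals -/

namespace FormalCalculus

open Filter

variable {V A : Type*} [AddCommGroup V] [Module ℂ V] [AddCommGroup A] [Module ℂ A]

section ModeExpansions

variable {M : Type*} [AddCommGroup M] [Module ℂ M]

/-- The pairing of an operator-valued series `∑ₙ Tₙ x^{-n-1}` with `(x - z)^p x^q` at `∞`. -/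
noncomputable def infinityMode (z : ℂ) (T : ℤ → Module.End ℂ A)
    (hT : ∀ a, ∀ᶠ n in atBot, T n a = 0) (p q : ℤ) : Module.End ℂ A where
  toFun a := atInfinity z (fun n => T n a) p q
  map_add' a b := by
    simp only [atInfinity, map_add, smul_add]
    exact binomSum_add _ (eventually_smul _ (eventually_sub (hT a) _))
      (eventually_smul _ (eventually_sub (hT b) _))
  map_smul' c a := by
    simpa using (map_atInfinity z (hT a) (LinearMap.lsmul ℂ A c) p q).symm

/-- The pairing of an operator-valued series `∑ₙ Tₙ x^{-n-1}` with `(x - z)^p x^q` at `0`. -/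
noncomputable def originMode (z : ℂ) (T : ℤ → Module.End ℂ A)
    (hT : ∀ a, ∀ᶠ n in atTop, T n a = 0) (p q : ℤ) : Module.End ℂ A where
  toFun a := atOrigin z (fun n => T n a) p q
  map_add' a b := by
    simp only [atOrigin, map_add, smul_add]
    rw [← smul_add]
    congr 1
    exact binomSum_add _ (eventually_smul _ (eventually_add (hT a) _))
      (eventually_smul _ (eventually_add (hT b) _))
  map_smul' c a := by
    simpa using (map_atOrigin z (hT a) (LinearMap.lsmul ℂ A c) p q).symm

theorem infinityMode_eq_zero (z : ℂ) (T : ℤ → Module.End ℂ A)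
    (hT : ∀ a, ∀ᶠ n in atBot, T n a = 0) (a : A) :
    ∃ K : ℤ, ∀ p q, p + q ≤ K → infinityMode z T hT p q a = 0 := by
  obtain ⟨K, hK⟩ := eventually_atBot.1 (hT a)
  exact ⟨K, fun p q h => atInfinity_eq_zero z hK h⟩

theorem originMode_eq_zero (z : ℂ) (T : ℤ → Module.End ℂ A)
    (hT : ∀ a, ∀ᶠ n in atTop, T n a = 0) (a : A) :
    ∃ K : ℤ, ∀ p q, K ≤ q → originMode z T hT p q a = 0 := by
  obtain ⟨K, hK⟩ := eventually_atTop.1 (hT a)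
  exact ⟨K, fun p q h => atOrigin_eq_zero z hK h⟩

/-- Along the expansion of (x₁ - x₂)^l the exponent of x₁ falls and that of x₂ rises. At infinity
the operator acting first must therefore carry x₁; in `admissible_origin` it carries x₂. This
accounts for the reversed products of P. -/
theorem admissible_infinity {S T : ℤ → ℤ → Module.End ℂ A}
    (hS : ∀ a, ∃ K : ℤ, ∀ p q, p + q ≤ K → S p q a = 0)
    (hT : ∀ a, ∃ K : ℤ, ∀ p q, p + q ≤ K → T p q a = 0) (a : A) :
    Admissible atBot fun m p n q => S n q (T m p a) := by
  obtain ⟨K, hK⟩ := hT a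
  refine ⟨fun m p n q => ?_, fun m n q => ?_, fun m p n => ?_⟩
  · exact eventually_atTop.2 ⟨(m + p - K).toNat, fun i hi => by rw [hK _ _ (by omega), map_zero]⟩
  · exact eventually_atBot.2 ⟨K - m, fun p hp i => by rw [hK _ _ (by omega), map_zero]⟩
  · have h : ∀ᶠ q in atBot, ∀ i ∈ Finset.range (m + p - K).toNat,
        S n (q + i) (T m (p - i) a) = 0 := by
      refine (eventually_all_finset _).2 fun i _ => ?_
      obtain ⟨K', hK'⟩ := hS (T m (p - i) a)
      exact eventually_atBot.2 ⟨K' - n - i, fun q hq => hK' _ _ (by omega)⟩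
    filter_upwards [h] with q hq i
    by_cases hi : i < (m + p - K).toNat
    · exact hq i (Finset.mem_range.2 hi)
    · rw [hK _ _ (by omega), map_zero]

theorem admissible_origin {S T : ℤ → ℤ → Module.End ℂ A}
    (hS : ∀ a, ∃ K : ℤ, ∀ p q, K ≤ q → S p q a = 0)
    (hT : ∀ a, ∃ K : ℤ, ∀ p q, K ≤ q → T p q a = 0) (a : A) :
    Admissible atTop fun m p n q => S m p (T n q a) := by
  obtain ⟨K, hK⟩ := hT a
  refine ⟨fun m p n q => ?_, fun m n q => ?_, fun m p n => ?_⟩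
  · exact eventually_atTop.2 ⟨(K - q).toNat, fun i hi => by rw [hK _ _ (by omega), map_zero]⟩
  · have h : ∀ᶠ p in atTop, ∀ i ∈ Finset.range (K - q).toNat,
        S m (p - i) (T n (q + i) a) = 0 := by
      refine (eventually_all_finset _).2 fun i _ => ?_
      obtain ⟨K', hK'⟩ := hS (T n (q + i) a)
      exact eventually_atTop.2 ⟨K' + i, fun p hp => hK' _ _ (by omega)⟩
    filter_upwards [h] with p hp i
    by_cases hi : i < (K - q).toNat
    · exact hp i (Finset.mem_range.2 hi)
    · rw [hK _ _ (by omega), map_zero]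
  · exact eventually_atTop.2 ⟨K, fun q hq i => by rw [hK _ _ (by omega), map_zero]⟩

end ModeExpansions

/-- Two commuting vertex operator maps on `A`: one satisfying the opposite Jacobi identity, with
coefficients in `A((x⁻¹))`, and one satisfying the Jacobi identity, with coefficients in
`A((x))`. -/
structure OppositePair (YV : Modes V V) (A : Type*) [AddCommGroup A] [Module ℂ A] where
  /-- the operators satisfying the opposite Jacobi identity -/
  P : Modes V A
  /-- the operators satisfying the Jacobi identity -/
  Q : Modes V A
  truncation : LowerTruncated YV
  truncation_P : ∀ v a, ∀ᶠ n in atBot, P v n a = 0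
  truncation_Q : ∀ v a, ∀ᶠ n in atTop, Q v n a = 0
  jacobi_P : ∀ (u v : V) (a : A) (l p q : ℤ),
    altSum l (fun i => P v (q + i) (P u (l + p - i) a))
      - (-1 : ℂ) ^ l • altSum l (fun i => P u (p + i) (P v (l + q - i) a))
      = binomSum p fun i => P (YV u (l + i) v) (p + q - i) a
  jacobi_Q : ∀ (u v : V) (a : A) (l p q : ℤ),
    altSum l (fun i => Q u (l + p - i) (Q v (q + i) a))
      - (-1 : ℂ) ^ l • altSum l (fun i => Q v (l + q - i) (Q u (p + i) a))
      = binomSum p fun i => Q (YV u (l + i) v) (p + q - i) a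
  commute : ∀ (u v : V) (m n : ℤ) (a : A), P u m (Q v n a) = Q v n (P u m a)

namespace OppositePair

variable {YV : Modes V V} (D : OppositePair YV A) (z : ℂ)

/-- The coefficients of `P(v, x)` against `(x - z)^p x^q`. -/
noncomputable def PM (v : V) : ℤ → ℤ → Module.End ℂ A :=
  infinityMode z (D.P v) (D.truncation_P v)

/-- The coefficients of `Q(v, x)` against `(x - z)^p x^q`. -/
noncomputable def QM (v : V) : ℤ → ℤ → Module.End ℂ A :=
  originMode z (D.Q v) (D.truncation_Q v)

theorem PM_apply (v : V) (p q : ℤ) (a : A) :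
    D.PM z v p q a = atInfinity z (fun n => D.P v n a) p q := rfl

theorem QM_apply (v : V) (p q : ℤ) (a : A) :
    D.QM z v p q a = atOrigin z (fun n => D.Q v n a) p q := rfl

theorem PM_zero_left (v : V) (q : ℤ) (a : A) : D.PM z v 0 q a = D.P v q a := by
  rw [PM_apply, atInfinity_zero_left]

theorem QM_zero_left (v : V) (q : ℤ) (a : A) : D.QM z v 0 q a = D.Q v q a := by
  rw [QM_apply, atOrigin_zero_left]

theorem PM_zero (p q : ℤ) (a : A) : D.PM z 0 p q a = 0 := by
  rw [PM_apply, atInfinity_eq_zero z (K := p + q) (fun n _ => by simp) le_rfl]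

theorem QM_zero (p q : ℤ) (a : A) : D.QM z 0 p q a = 0 := by
  rw [QM_apply, atOrigin_eq_zero z (K := q) (fun n _ => by simp) le_rfl]

theorem PM_isShift (v : V) (a : A) : IsShift z fun p q => D.PM z v p q a :=
  atInfinity_isShift z (D.truncation_P v a)

theorem PM_truncation (v : V) (a : A) : ∃ K : ℤ, ∀ p q, p + q ≤ K → D.PM z v p q a = 0 :=
  infinityMode_eq_zero z _ _ a

theorem QM_truncation (v : V) (a : A) : ∃ K : ℤ, ∀ p q, K ≤ q → D.QM z v p q a = 0 :=
  originMode_eq_zero z _ _ a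

theorem PM_QM_commute (u v : V) (m p n q : ℤ) (a : A) :
    D.PM z u m p (D.QM z v n q a) = D.QM z v n q (D.PM z u m p a) := by
  rw [PM_apply, PM_apply, map_atInfinity z (D.truncation_P u a)]
  congr 1
  funext k
  rw [QM_apply, map_atOrigin z (D.truncation_Q v a), QM_apply]
  simp only [D.commute]

include D in
theorem iterate_truncation (u v : V) : ∀ᶠ s in atTop, YV u s v = 0 :=
  eventually_atTop.2 (D.truncation u v)

theorem jacobi_PM (u v : V) (a : A) (l m p n q : ℤ) :
    expandFirst l (fun m p n q => D.PM z v n q (D.PM z u m p a)) m p n q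
      - (-1 : ℂ) ^ l • expandFirst l (fun n q m p => D.PM z u m p (D.PM z v n q a)) n q m p
      = iterate (fun s p q => D.PM z (YV u s v) p q a) l m p n q := by
  refine jacobi_extend (F := atBot) (z := z) (fun c => tendsto_atBot_add_const_left _ c tendsto_id)
    (fun X hX h₀ hb => hX.eq_zero_of_atBot h₀ hb)
    (admissible_infinity (D.PM_truncation z v) (D.PM_truncation z u) a)
    (admissible_infinity (D.PM_truncation z u) (D.PM_truncation z v) a)
    (fun n q => (D.PM_isShift z u a).map _) (fun m p => D.PM_isShift z v _)
    (fun n q => (D.PM_isShift z v a).map _) (fun m p => D.PM_isShift z u _) ?_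
    (fun s => D.PM_isShift z _ a) (fun s p => ?_) l (fun p q => ?_) m p n q
  · filter_upwards [D.iterate_truncation u v] with s hs p q
    rw [hs, PM_zero]
  · obtain ⟨K, hK⟩ := D.PM_truncation z (YV u s v) a
    exact eventually_atBot.2 ⟨K - p, fun q hq => hK _ _ (by omega)⟩
  · simpa only [expandFirst, iterate, PM_zero_left, binomSum_zero_left, add_zero, Nat.cast_zero,
      sub_zero] using D.jacobi_P u v a l p q

variable {z} (hz : z ≠ 0)
include hz

theorem QM_isShift (v : V) (a : A) : IsShift z fun p q => D.QM z v p q a :=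
  atOrigin_isShift hz (D.truncation_Q v a)

theorem jacobi_QM (u v : V) (a : A) (l m p n q : ℤ) :
    expandFirst l (fun m p n q => D.QM z u m p (D.QM z v n q a)) m p n q
      - (-1 : ℂ) ^ l • expandFirst l (fun n q m p => D.QM z v n q (D.QM z u m p a)) n q m p
      = iterate (fun s p q => D.QM z (YV u s v) p q a) l m p n q := by
  refine jacobi_extend (F := atTop) (z := z) (fun c => tendsto_atTop_add_const_left _ c tendsto_id)
    (fun X hX h₀ hb => hX.eq_zero_of_atTop hz h₀ hb)
    (admissible_origin (D.QM_truncation z u) (D.QM_truncation z v) a)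
    (admissible_origin (D.QM_truncation z v) (D.QM_truncation z u) a)
    (fun n q => D.QM_isShift hz u _) (fun m p => (D.QM_isShift hz v a).map _)
    (fun n q => D.QM_isShift hz v _) (fun m p => (D.QM_isShift hz u a).map _) ?_
    (fun s => D.QM_isShift hz _ a) (fun s p => ?_) l (fun p q => ?_) m p n q
  · filter_upwards [D.iterate_truncation u v] with s hs p q
    rw [hs, QM_zero]
  · obtain ⟨K, hK⟩ := D.QM_truncation z (YV u s v) a
    exact eventually_atTop.2 ⟨K, fun q hq => hK _ _ hq⟩
  · simpa only [expandFirst, iterate, QM_zero_left, binomSum_zero_left, add_zero, Nat.cast_zero,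
      sub_zero] using D.jacobi_Q u v a l p q

omit hz

variable (z)

/-- The difference of the pairings of `⟨f, P(v, x) a⟩` and `⟨f, Q(v, x) a⟩` with
`(x - z)^p x^q`. -/
noncomputable def gap (f : Module.Dual ℂ A) (v : V) (a : A) (p q : ℤ) : ℂ :=
  f (D.PM z v p q a) - f (D.QM z v p q a)

/-- The modes of `x₀⁻¹ δ((x₁-z)/x₀) f ∘ P(v,x₁) - x₀⁻¹ δ((z-x₁)/(-x₀)) f ∘ Q(v,x₁)`, with residue
taken in `x₁`. -/
noncomputable def dualMode (v : V) (n : ℤ) (f : Module.Dual ℂ A) : Module.Dual ℂ A :=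
  f ∘ₗ (D.PM z v n 0 - D.QM z v n 0)

theorem dualMode_apply (v : V) (n : ℤ) (f : Module.Dual ℂ A) (a : A) :
    D.dualMode z v n f a = D.gap z f v a n 0 := by
  simp [dualMode, gap]

/-- `(x - z)^k ⟨f, P(v, x) a⟩ = (x - z)^k ⟨f, Q(v, x) a⟩` for large `k`, uniformly in `a`. -/
def IsLocal (f : Module.Dual ℂ A) : Prop :=
  ∀ v, ∀ᶠ p in atTop, ∀ q a, D.gap z f v a p q = 0

variable {z} (hz : z ≠ 0) {f : Module.Dual ℂ A}
include hz

theorem gap_isShift (f : Module.Dual ℂ A) (v : V) (a : A) : IsShift z (D.gap z f v a) :=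
  ((D.PM_isShift z v a).map f).sub ((D.QM_isShift hz v a).map f)

/-- Mixed products commute, so only the PP and QQ commutators contribute, given by the Jacobi
identities at l = 0. Products of P are reversed, so the two commutators enter with opposite signs
and combine into gaps. -/
theorem gap_dualMode (f : Module.Dual ℂ A) (u v : V) (a : A) (n p q : ℤ) :
    D.gap z (D.dualMode z u n f) v a p q =
      D.gap z f v (D.PM z u n 0 a) p q - D.gap z f v (D.QM z u n 0 a) p q +
        iterate (fun s p q => D.gap z f (YV v s u) a p q) 0 p q n 0 := by
  have hP := D.jacobi_PM z v u a 0 p q n 0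
  have hQ := D.jacobi_QM hz v u a 0 p q n 0
  simp only [expandFirst, altSum_zero_left, zpow_zero, one_smul, Nat.cast_zero, add_zero, zero_add,
    sub_zero] at hP hQ
  have hW : ∀ T : V → ℤ → ℤ → Module.End ℂ A, (∀ p q, T 0 p q a = 0) →
      f (iterate (fun s p q => T (YV v s u) p q a) 0 p q n 0) =
        iterate (fun s p q => f (T (YV v s u) p q a)) 0 p q n 0 := by
    intro T hT
    have hT' : ∀ᶠ s in atTop, ∀ p q, T (YV v s u) p q a = 0 := by
      filter_upwards [D.iterate_truncation v u] with s hs p q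
      rw [hs, hT]
    simp only [iterate]
    rw [map_binomSum _ (iterate_finite_left hT' ..)]
    congr 1
    funext j
    rw [map_binomSum _ (iterate_finite_right hT' ..)]
  have hv : ∀ T : V → ℤ → ℤ → Module.End ℂ A, (∀ p q, T 0 p q a = 0) →
      ∀ᶠ s in atTop, ∀ p q, f (T (YV v s u) p q a) = 0 := by
    intro T hT
    filter_upwards [D.iterate_truncation v u] with s hs p q
    rw [hs, hT, map_zero]
  have hsub : iterate (fun s p q => D.gap z f (YV v s u) a p q) 0 p q n 0 =
      iterate (fun s p q => f (D.PM z (YV v s u) p q a)) 0 p q n 0 -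
        iterate (fun s p q => f (D.QM z (YV v s u) p q a)) 0 p q n 0 := by
    have h₁ := hv (D.PM z) (D.PM_zero z · · a)
    have h₂ := hv (D.QM z) (D.QM_zero z · · a)
    simp only [iterate]
    rw [← binomSum_sub _ (iterate_finite_left h₁ ..) (iterate_finite_left h₂ ..)]
    congr 1
    funext j
    rw [← binomSum_sub _ (iterate_finite_right h₁ ..) (iterate_finite_right h₂ ..)]
    rfl
  rw [hsub, ← hW (D.PM z) (D.PM_zero z · · a), ← hW (D.QM z) (D.QM_zero z · · a), ← hP, ← hQ]
  simp only [gap, dualMode, LinearMap.comp_apply, LinearMap.sub_apply, map_sub, PM_QM_commute]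
  ring

/-- A Dong-type argument: in `gap_dualMode` the exponents of x - z grow with p, and only finitely
many modes of v on u are involved, so one threshold serves all terms. The gaps at displaced vectors
vanish because locality is uniform in a. -/
theorem IsLocal.dualMode (hf : D.IsLocal z f) (u : V) (n : ℤ) :
    D.IsLocal z (D.dualMode z u n f) := by
  intro v
  obtain ⟨S, hS⟩ := eventually_atTop.1 (D.iterate_truncation v u)
  have h : ∀ᶠ p in atTop, ∀ j ∈ Finset.range S.toNat, ∀ k ∈ Finset.range S.toNat, ∀ q a,
      D.gap z f (YV v (0 + j + k) u) a (p + n - j) q = 0 := by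
    refine (eventually_all_finset _).2 fun j _ => (eventually_all_finset _).2 fun k _ => ?_
    obtain ⟨K, hK⟩ := eventually_atTop.1 (hf (YV v (0 + j + k) u))
    exact eventually_atTop.2 ⟨K - n + j, fun p hp => hK _ (by omega)⟩
  filter_upwards [h, hf v] with p hp hp' q a
  rw [D.gap_dualMode hz, hp', hp', sub_zero, zero_add]
  refine binomSum_eq_zero _ fun j => binomSum_eq_zero _ fun k => ?_
  beta_reduce
  by_cases hj : j < S.toNat
  · by_cases hk : k < S.toNat
    · exact hp j (Finset.mem_range.2 hj) k (Finset.mem_range.2 hk) _ _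
    · rw [hS _ (by omega)]
      simp only [gap, PM_zero, QM_zero, sub_self]
  · rw [hS _ (by omega)]
    simp only [gap, PM_zero, QM_zero, sub_self]

/-- The product of two dual modes, in terms of products of modes of `P` and `Q`. -/
theorem altSum_dualMode (hf : D.IsLocal z f) (u v : V) (a : A) (l m n : ℤ) :
    altSum l (fun i => D.dualMode z u (l + m - i) (D.dualMode z v (n + i) f) a) =
      altSum l (fun i => f (D.PM z v n i (D.PM z u m (l - i) a)))
        - altSum l (fun i => f (D.PM z u m (l - i) (D.QM z v n i a)))
        - (-1 : ℂ) ^ l • (altSum l (fun i => f (D.PM z v n (l - i) (D.QM z u m i a)))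
          - altSum l fun i => f (D.QM z v n (l - i) (D.QM z u m i a))) := by
  obtain ⟨K, hK⟩ := D.PM_truncation z u a
  obtain ⟨K', hK'⟩ := D.QM_truncation z u a
  obtain ⟨B, hB⟩ := eventually_atTop.1 (hf v)
  have sP : ∀ w b, IsShift z fun p q => D.PM z w p q b := D.PM_isShift z
  have sQ : ∀ w b, IsShift z fun p q => D.QM z w p q b := D.QM_isShift hz
  have eP : ∀ T : ℤ → ℤ → Module.End ℂ A, ∀ᶠ i : ℕ in atTop,
      f (T (n + i) 0 (D.PM z u (l + m - i) 0 a)) = 0 := fun T =>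
    eventually_atTop.2 ⟨(l + m - K).toNat, fun i hi => by rw [hK _ _ (by omega)]; simp⟩
  -- When the operator of u is expanded at infinity, x₁ dominates x₂ whether v is paired at infinity
  -- or at 0, so passing from yᵢ to xᵢ does not alter the expansion.
  have hP := altSum_translate (z := z) (Φ := fun m p n q => f (D.PM z v n q (D.PM z u m p a)))
    (fun n q => (sP u a).map (f ∘ₗ D.PM z v n q)) (fun m p => (sP v _).map f) (K := K)
    (fun m p n q h => by simp only [hK _ _ h, map_zero]) l m n
  have hQ := altSum_translate (z := z) (Φ := fun m p n q => f (D.QM z v n q (D.PM z u m p a)))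
    (fun n q => (sP u a).map (f ∘ₗ D.QM z v n q)) (fun m p => (sQ v _).map f) (K := K)
    (fun m p n q h => by simp only [hK _ _ h, map_zero]) l m n
  -- When u contributes Q, its variable lies near 0 and the gap in v is a pairing near z. Here v
  -- occupies the first variable of the lemma, and (y₁ - y₂)^l becomes an expansion in small x₁;
  -- locality of f provides the bound `B`.
  have hR := altSum_reverse (z := z) (Ψ := fun n q m p => D.gap z f v (D.QM z u m p a) n q)
    (fun m p => D.gap_isShift hz f v _)
    (fun n q => ((sQ u a).map (f ∘ₗ D.PM z v n q)).sub ((sQ u a).map (f ∘ₗ D.QM z v n q)))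
    (K := B) (fun n q m p h => hB _ h _ _)
    (fun m => eventually_atTop.2 ⟨K', fun p hp n q => by
      simp only [gap, hK' _ _ hp, map_zero, sub_zero]⟩) l n m
  have eR : ∀ T : ℤ → ℤ → Module.End ℂ A, ∀ᶠ i : ℕ in atTop,
      f (T n (l - i) (D.QM z u m i a)) = 0 := fun T =>
    eventually_atTop.2 ⟨K'.toNat, fun i hi => by rw [hK' _ _ (by omega)]; simp⟩
  simp only [gap] at hR
  rw [altSum_sub _ (eR _) (eR _)] at hR
  simp only [PM_QM_commute] at hP hQ hR ⊢
  rw [hR, smul_smul, ← mul_zpow, neg_one_mul, neg_neg, one_zpow, one_smul, ← hP, ← hQ,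
    ← altSum_sub _ (eP _) (eP _), ← altSum_sub]
  · congr 1
    funext i
    simp only [dualMode, LinearMap.comp_apply, LinearMap.sub_apply, map_sub, PM_QM_commute]
  · filter_upwards [eP (D.PM z v), eP (D.QM z v)] with i h₁ h₂
    rw [h₁, h₂, sub_zero]
  -- The Q-terms of u are summed as differences: locality makes the gap of v vanish once n + i ≥ B.
  · refine eventually_atTop.2 ⟨(B - n).toNat, fun i hi => ?_⟩
    have := hB (n + i) (by omega) 0 (D.QM z u (l + m - i) 0 a)
    simpa only [gap, PM_QM_commute] using this

/-- The dual modes satisfy the Jacobi identity on local functionals. -/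
theorem jacobi_dualMode (hf : D.IsLocal z f) (u v : V) (a : A) (l m n : ℤ) :
    altSum l (fun i => D.dualMode z u (l + m - i) (D.dualMode z v (n + i) f) a)
      - (-1 : ℂ) ^ l • altSum l (fun i => D.dualMode z v (l + n - i) (D.dualMode z u (m + i) f) a)
      = binomSum m fun i => D.dualMode z (YV u (l + i) v) (m + n - i) f a := by
  have hP := congrArg f (D.jacobi_PM z u v a l m 0 n 0)
  have hQ := congrArg f (D.jacobi_QM hz u v a l m 0 n 0)
  have aP : ∀ u v, Admissible atBot fun m p n q => D.PM z v n q (D.PM z u m p a) := fun u v =>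
    admissible_infinity (D.PM_truncation z v) (D.PM_truncation z u) a
  have aQ : ∀ u v, Admissible atTop fun m p n q => D.QM z u m p (D.QM z v n q a) := fun u v =>
    admissible_origin (D.QM_truncation z u) (D.QM_truncation z v) a
  have eW : ∀ T : V → ℤ → ℤ → Module.End ℂ A, (∀ p q, T 0 p q a = 0) →
      ∀ᶠ i : ℕ in atTop, T (YV u (l + i) v) (m + n - i) 0 a = 0 := by
    intro T hT
    obtain ⟨S, hS⟩ := eventually_atTop.1 (D.iterate_truncation u v)
    exact eventually_atTop.2 ⟨(S - l).toNat, fun i hi => by rw [hS _ (by omega), hT]⟩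
  have eP := eW (D.PM z) (D.PM_zero z · · a)
  have eQ := eW (D.QM z) (D.QM_zero z · · a)
  simp only [expandFirst, iterate, binomSum_zero_left, add_zero, zero_add, Nat.cast_zero,
    sub_zero, map_sub, map_smul] at hP hQ
  rw [map_altSum _ (by simpa using (aP u v).finite m l n 0),
    map_altSum _ (by simpa using (aP v u).finite n l m 0), map_binomSum _ eP] at hP
  rw [map_altSum _ (by simpa using (aQ u v).finite m l n 0),
    map_altSum _ (by simpa using (aQ v u).finite n l m 0), map_binomSum _ eQ] at hQ
  have hR : (binomSum m fun i => D.dualMode z (YV u (l + i) v) (m + n - i) f a) =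
      (binomSum m fun i => f (D.PM z (YV u (l + i) v) (m + n - i) 0 a)) -
        binomSum m fun i => f (D.QM z (YV u (l + i) v) (m + n - i) 0 a) := by
    rw [← binomSum_sub]
    · simp only [dualMode_apply, gap]
    · filter_upwards [eP] with i hi
      rw [hi, map_zero]
    · filter_upwards [eQ] with i hi
      rw [hi, map_zero]
  -- In the two products the PQ terms coincide, and so do the QP terms, up to factors (-1)^l whose
  -- square is 1. What survives is f of the identity for P minus f of the identity for Q.
  rw [hR, ← hP, ← hQ, D.altSum_dualMode hz hf u v, D.altSum_dualMode hz hf v u]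
  have hl : ((-1 : ℂ) ^ l) * (-1) ^ l = 1 := by
    rw [← mul_zpow, neg_one_mul, neg_neg, one_zpow]
  simp only [smul_eq_mul]
  generalize (-1 : ℂ) ^ l = e at hl ⊢
  generalize altSum l (fun i => f (D.PM z u m (l - i) (D.QM z v n i a))) = x₁
  generalize altSum l (fun i => f (D.QM z u m (l - i) (D.QM z v n i a))) = x₂
  linear_combination (x₁ - x₂) * hl

end OppositePair

end FormalCalculus

open Filter FormalCalculus

/-! ### Binomial identities and divided powers -/

section Combinatorics

theorem Ring.succ_mul_choose (N : ℤ) (k : ℕ) :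
    ((k : ℤ) + 1) * Ring.choose N (k + 1) = (N - k) * Ring.choose N k := by
  have h := Ring.choose_smul_choose N (Nat.le_succ k)
  rw [Nat.succ_eq_add_one, Nat.choose_succ_self_right, Nat.add_sub_cancel_left,
    Ring.choose_one_right, nsmul_eq_mul] at h
  push_cast at h
  rw [h, mul_comm]

/-- Negating upper indices replaces C(M - x₁, x₂) by (-1)^{x₂} C(t - 1 - M, x₂), as x₁ + x₂ = t. The
new upper index is constant, so Vandermonde applies, and a second negation returns the result. -/
theorem Ring.sum_antidiagonal_choose_sub (M m : ℤ) (t : ℕ) :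
    ∑ x ∈ Finset.HasAntidiagonal.antidiagonal t, (-1) ^ x.1 * Ring.choose m x.1 * Ring.choose (M - x.1) x.2
      = Ring.choose (M - m) t := by
  have h : ∀ (N : ℤ) (k : ℕ), Ring.choose N k = (-1) ^ k * Ring.choose (k - 1 - N) k := by
    intro N k
    have := Ring.choose_neg (-N) k
    rw [neg_neg] at this
    rw [this, Int.negOnePow_def, Units.smul_def]
    simp only [zpow_natCast, Units.val_pow_eq_pow_val, Units.val_neg, Units.val_one, smul_eq_mul]
    congr 2
    ring
  have e := Ring.add_choose_eq t (Commute.all m ((t : ℤ) - 1 - M))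
  rw [h (M - m) t, show (t : ℤ) - 1 - (M - m) = m + (t - 1 - M) by ring, e, Finset.mul_sum]
  refine Finset.sum_congr rfl fun x hx => ?_
  have hx' := Finset.HasAntidiagonal.mem_antidiagonal.1 hx
  rw [h (M - x.1) x.2, ← hx', pow_add,
    show (x.2 : ℤ) - 1 - (M - x.1) = ((x.1 + x.2 : ℕ) : ℤ) - 1 - M by push_cast; ring]
  ring

theorem Finset.sum_range_antidiagonal {M : Type*} [AddCommMonoid M] (F : ℕ → ℕ → M) (J K S : ℕ)
    (hS : J + K ≤ S) (h₁ : ∀ a b, J ≤ a → F a b = 0) (h₂ : ∀ a b, K ≤ b → F a b = 0) :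
    ∑ s ∈ Finset.range S, ∑ x ∈ Finset.HasAntidiagonal.antidiagonal s, F x.1 x.2
      = ∑ a ∈ Finset.range J, ∑ b ∈ Finset.range K, F a b := by
  rw [← Finset.sum_product' (Finset.range J) (Finset.range K) F,
    ← Finset.sum_fiberwise_of_maps_to (t := Finset.range S) (g := fun x : ℕ × ℕ => x.1 + x.2)]
  · refine Finset.sum_congr rfl fun s _ => (Finset.sum_subset ?_ ?_).symm
    · intro x hx
      exact Finset.HasAntidiagonal.mem_antidiagonal.2 (Finset.mem_filter.1 hx).2
    · intro x hx hx'
      by_contra hF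
      refine hx' (Finset.mem_filter.2 ⟨Finset.mem_product.2 ⟨?_, ?_⟩, Finset.HasAntidiagonal.mem_antidiagonal.1 hx⟩)
      · by_contra h
        exact hF (h₁ _ _ (by simpa using h))
      · by_contra h
        exact hF (h₂ _ _ (by simpa using h))
  · intro x hx
    have := Finset.mem_product.1 hx
    simp only [Finset.mem_range] at this ⊢
    omega

/-- The divided power `T^j / j!`. -/
noncomputable def dividedPower {V : Type*} [AddCommGroup V] [Module ℂ V] (T : Module.End ℂ V)
    (j : ℕ) : Module.End ℂ V := ((j.factorial : ℂ)⁻¹) • T ^ j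

variable {V : Type*} [AddCommGroup V] [Module ℂ V]

theorem dividedPower_zero (T : Module.End ℂ V) (v : V) : dividedPower T 0 v = v := by
  simp [dividedPower]

theorem apply_dividedPower (T : Module.End ℂ V) (j : ℕ) (v : V) :
    T (dividedPower T j v) = ((j : ℂ) + 1) • dividedPower T (j + 1) v := by
  have h : ((j : ℂ) + 1) ≠ 0 := by exact_mod_cast Nat.succ_ne_zero j
  simp only [dividedPower, LinearMap.smul_apply, map_smul, smul_smul, pow_succ',
    Module.End.mul_apply, Nat.factorial_succ]
  congr 1
  push_cast
  field_simp

theorem sum_antidiagonal_left {M : Type*} [AddCommGroup M] [Module ℂ M] (F : ℕ × ℕ → M) (s : ℕ) :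
    ∑ x ∈ Finset.HasAntidiagonal.antidiagonal (s + 1), (x.1 : ℂ) • F x
      = ∑ x ∈ Finset.HasAntidiagonal.antidiagonal s, ((x.1 : ℂ) + 1) • F (x.1 + 1, x.2) := by
  rw [Finset.Nat.sum_antidiagonal_succ]
  simp

theorem sum_antidiagonal_right {M : Type*} [AddCommGroup M] [Module ℂ M] (F : ℕ × ℕ → M) (s : ℕ) :
    ∑ x ∈ Finset.HasAntidiagonal.antidiagonal (s + 1), (x.2 : ℂ) • F x
      = ∑ x ∈ Finset.HasAntidiagonal.antidiagonal s, ((x.2 : ℂ) + 1) • F (x.1, x.2 + 1) := by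
  rw [Finset.Nat.sum_antidiagonal_succ']
  simp

/-- Leibniz rule for divided powers. -/
theorem dividedPower_apply {T : Module.End ℂ V} {D : ℕ → Module.End ℂ V}
    (hD : ∀ a v, T (D a v) = ((a : ℂ) + 1) • D (a + 1) v + D a (T v)) (s : ℕ) (v : V) :
    dividedPower T s (D 0 v) = ∑ x ∈ Finset.HasAntidiagonal.antidiagonal s, D x.1 (dividedPower T x.2 v) := by
  induction s with
  | zero => simp [dividedPower_zero]
  | succ s ih =>
    have h : ((s : ℂ) + 1) ≠ 0 := by exact_mod_cast Nat.succ_ne_zero s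
    refine smul_right_injective V h ?_
    simp only
    rw [← apply_dividedPower, ih, map_sum, Finset.smul_sum]
    -- Splitting s + 1 as x.1 + x.2 separates the terms where T raises the index of D from those
    -- where it raises the divided power.
    have : ∀ x ∈ Finset.HasAntidiagonal.antidiagonal (s + 1), ((s : ℂ) + 1) • D x.1 (dividedPower T x.2 v) =
        (x.1 : ℂ) • D x.1 (dividedPower T x.2 v) + (x.2 : ℂ) • D x.1 (dividedPower T x.2 v) := by
      intro x hx
      rw [← add_smul, ← Nat.cast_add, Finset.HasAntidiagonal.mem_antidiagonal.1 hx]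
      push_cast
      rfl
    rw [Finset.sum_congr rfl this, Finset.sum_add_distrib,
      sum_antidiagonal_left fun x => D x.1 (dividedPower T x.2 v),
      sum_antidiagonal_right fun x => D x.1 (dividedPower T x.2 v), ← Finset.sum_add_distrib]
    refine Finset.sum_congr rfl fun x _ => ?_
    rw [hD, apply_dividedPower, map_smul]

end Combinatorics

/-! ### Conjugation of modes by exp(xL(1)) -/

namespace VertexOperatorAlgebra

variable {V : Type*} [AddCommGroup V] [Module ℂ V] (𝒱 : VertexOperatorAlgebra V)

theorem commutator {M : Type*} [AddCommGroup M] [Module ℂ M] {Y : Modes V M}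
    (hY : JacobiIdentity 𝒱.Y Y) (u v : V) (w : M) (m n : ℤ) :
    Y u m (Y v n w) - Y v n (Y u m w) = binomSum m fun i => Y (𝒱.Y u i v) (m + n - i) w := by
  have h := hY u v w 0 m n
  rw [← altSum_eq_finsum, ← altSum_eq_finsum, altSum_zero_left, altSum_zero_left] at h
  simpa [binomSum] using h

theorem binomSum_natCast {M : Type*} [AddCommGroup M] [Module ℂ M] (m : ℕ) (φ : ℕ → M) :
    binomSum m φ = ∑ i ∈ Finset.range (m + 1), ((m.choose i : ℕ) : ℂ) • φ i := by
  refine (finsum_eq_sum_of_support_subset _ fun i hi => ?_).trans (Finset.sum_congr rfl ?_)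
  · by_contra h
    simp only [Finset.coe_range, Set.mem_Iio, not_lt] at h
    refine hi ?_
    simp only [Ring.choose_natCast, Nat.choose_eq_zero_of_lt h, Nat.cast_zero, Int.cast_zero,
      zero_smul]
  · intro i _
    simp [Ring.choose_natCast]

theorem mode_mem {h h' : ℤ} {u v : V} (hu : u ∈ 𝒱.weightSpace h) (hv : v ∈ 𝒱.weightSpace h')
    (n : ℤ) : 𝒱.Y u n v ∈ 𝒱.weightSpace (h + h' - n - 1) := by
  have e := 𝒱.commutator 𝒱.jacobi 𝒱.conformal u v 1 n
  rw [weightSpace, Module.End.mem_eigenspace_iff] at hu hv ⊢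
  have e₁ := 𝒱.derivative u (1 + n)
  rw [show (1 : ℤ) = (1 : ℕ) from rfl, binomSum_natCast] at e
  simp only [Finset.sum_range_succ, Finset.sum_range_zero, Nat.cast_one, Nat.cast_zero, sub_zero,
    e₁, hu, hv, Nat.choose_zero_right, Nat.choose_self, one_smul, map_smul, Pi.smul_apply,
    LinearMap.smul_apply, zero_add] at e
  rw [sub_eq_iff_eq_add] at e
  rw [e, add_sub_cancel_left, ← add_smul, ← add_smul]
  congr 1
  push_cast
  ring

/-- The commutator with the mode ω₂ has three terms, coming from L(-1)u, L(0)u and L(1)u; the first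
two reduce to multiples of the (n+1)-st mode of u by the derivative property and homogeneity. -/
theorem L_one_mode {h : ℤ} {u : V} (hu : u ∈ 𝒱.weightSpace h) (v : V) (n : ℤ) :
    𝒱.L 1 (𝒱.Y u n v) = 𝒱.Y (𝒱.L 1 u) n v + ((2 * h - n - 2 : ℤ) : ℂ) • 𝒱.Y u (n + 1) v
      + 𝒱.Y u n (𝒱.L 1 v) := by
  have e := 𝒱.commutator 𝒱.jacobi 𝒱.conformal u v 2 n
  rw [weightSpace, Module.End.mem_eigenspace_iff] at hu
  have e₁ := 𝒱.derivative u (2 + n)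
  rw [show (2 : ℤ) = (2 : ℕ) from rfl, binomSum_natCast] at e
  simp only [Finset.sum_range_succ, Finset.sum_range_zero, Nat.cast_one, Nat.cast_zero, sub_zero,
    e₁, hu, Nat.choose_zero_right, Nat.choose_self, one_smul, map_smul, Pi.smul_apply,
    LinearMap.smul_apply, zero_add, Nat.cast_ofNat, Nat.choose_one_right] at e
  rw [sub_eq_iff_eq_add] at e
  simp only [L]
  rw [show (1 : ℤ) + 1 = 2 from rfl, e, show 2 + n - 1 = n + 1 by ring,
    show 2 + n - 2 = n by ring, smul_smul, ← add_smul, add_comm (_ • _) (𝒱.Y _ n v)]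
  congr 3
  push_cast
  ring

/-- `e_j = L(1)^j / j!`. -/
noncomputable def expL (j : ℕ) : Module.End ℂ V := dividedPower (𝒱.L 1) j

theorem expL_mem {h : ℤ} {v : V} (hv : v ∈ 𝒱.weightSpace h) (j : ℕ) :
    𝒱.expL j v ∈ 𝒱.weightSpace (h - j) :=
  Submodule.smul_mem _ _ (𝒱.L_one_pow_mem hv j)

theorem expL_eq_zero {h : ℤ} {v : V} (hv : v ∈ 𝒱.weightSpace h) :
    ∃ J : ℕ, ∀ j, J ≤ j → 𝒱.expL j v = 0 := by
  obtain ⟨N, hN⟩ := 𝒱.bounded_below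
  refine ⟨(h - N).toNat + 1, fun j hj => ?_⟩
  have := 𝒱.expL_mem hv j
  rwa [weightSpace, hN _ (by omega), Submodule.mem_bot] at this

/-- The coefficients of `e^{xL(1)} uᵢ e^{-xL(1)}`. -/
noncomputable def expLMode (h i : ℤ) (u : V) (a : ℕ) : Module.End ℂ V :=
  ∑ x ∈ Finset.HasAntidiagonal.antidiagonal a,
    ((Ring.choose (2 * h - 2 - i - x.1) x.2 : ℤ) : ℂ) • 𝒱.Y (𝒱.expL x.1 u) (i + x.2)

/-- This is the hypothesis of `dividedPower_apply`: commutation with L(1) advances the coefficients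
of the conjugated mode. -/
theorem L_one_expLMode {h : ℤ} {u : V} (hu : u ∈ 𝒱.weightSpace h) (i : ℤ) (a : ℕ) (v : V) :
    𝒱.L 1 (𝒱.expLMode h i u a v) =
      ((a : ℂ) + 1) • 𝒱.expLMode h i u (a + 1) v + 𝒱.expLMode h i u a (𝒱.L 1 v) := by
  simp only [expLMode, LinearMap.sum_apply, LinearMap.smul_apply, map_sum, map_smul,
    Finset.smul_sum]
  set E : ℕ × ℕ → V := fun x => 𝒱.Y (𝒱.expL x.1 u) (i + x.2) v with hE
  set N := 2 * h - 2 - i with hN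
  -- The binomial in the first summand has upper index N - x.1 + 1 so that, after shifting x.1 by
  -- one, it is the coefficient produced by L(1) acting on `expL x.1 u`.
  have h₁ : ∀ x ∈ Finset.HasAntidiagonal.antidiagonal (a + 1),
      ((a : ℂ) + 1) • ((Ring.choose (N - x.1) x.2 : ℤ) : ℂ) • 𝒱.Y (𝒱.expL x.1 u) (i + x.2) v =
        (x.1 : ℂ) • ((Ring.choose (N - x.1 + 1) x.2 : ℤ) : ℂ) • E x +
          ((((x.1 + x.2) * Ring.choose (N - x.1) x.2
            - x.1 * Ring.choose (N - x.1 + 1) x.2 : ℤ)) : ℂ) • E x := by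
    intro x hx
    have : (a : ℂ) + 1 = x.1 + x.2 := by exact_mod_cast (Finset.HasAntidiagonal.mem_antidiagonal.1 hx).symm
    rw [this, smul_smul, smul_smul, ← add_smul]
    congr 1
    push_cast
    ring
  rw [Finset.sum_congr rfl h₁, Finset.sum_add_distrib,
    sum_antidiagonal_left fun x => ((Ring.choose (N - x.1 + 1) x.2 : ℤ) : ℂ) • E x,
    Finset.Nat.sum_antidiagonal_succ']
  simp only [Ring.choose_zero_right, Nat.cast_zero, add_zero, mul_one, sub_self, Int.cast_zero,
    zero_smul, zero_add]
  rw [← Finset.sum_add_distrib, ← Finset.sum_add_distrib]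
  refine Finset.sum_congr rfl fun x _ => ?_
  rw [𝒱.L_one_mode (𝒱.expL_mem hu x.1), expL, apply_dividedPower, smul_add, smul_add]
  congr 1
  congr 1
  · simp only [hE, map_smul, Pi.smul_apply, LinearMap.smul_apply]
    rw [smul_comm]
    congr 3
    push_cast
    ring_nf
  -- Pascal's rule and (k + 1) C(N, k + 1) = (N - k) C(N, k) reduce the remaining coefficient to (N
  -- - 2 x.1 - x.2) C(N - x.1, x.2), the factor in `L_one_mode` for weight h - x.1.
  · rw [smul_smul, ← Int.cast_mul, hE]
    congr 2
    · rw [Ring.choose_succ_succ]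
      have := Ring.succ_mul_choose (N - x.1) x.2
      push_cast
      linear_combination -this
    · push_cast
      rw [add_assoc]
      rfl

theorem expL_mode {h : ℤ} {u : V} (hu : u ∈ 𝒱.weightSpace h) (i : ℤ) (s : ℕ) (v : V) :
    𝒱.expL s (𝒱.Y u i v) = ∑ x ∈ Finset.HasAntidiagonal.antidiagonal s, ∑ y ∈ Finset.HasAntidiagonal.antidiagonal x.1,
      ((Ring.choose (2 * h - 2 - i - y.1) y.2 : ℤ) : ℂ) •
        𝒱.Y (𝒱.expL y.1 u) (i + y.2) (𝒱.expL x.2 v) := by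
  have := dividedPower_apply (𝒱.L_one_expLMode hu i) s v
  simpa [expLMode, expL, dividedPower_zero] using this

theorem opposite_eq_sum {M : Type*} [AddCommGroup M] [Module ℂ M] (Y : Modes V M) {h : ℤ} {v : V}
    (hv : v ∈ 𝒱.weightSpace h) {J : ℕ} (hJ : ∀ j, J ≤ j → 𝒱.expL j v = 0) (m : ℤ) :
    𝒱.opposite Y v m =
      (-1 : ℂ) ^ h • ∑ j ∈ Finset.range J, Y (𝒱.expL j v) (2 * h - 2 - m - j) := by
  have hk : ∀ k : ℤ, 𝒱.oppositeCoeff k v =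
      if 0 ≤ k + 2 * h then (-1 : ℂ) ^ h • 𝒱.expL (k + 2 * h).toNat v else 0 := by
    intro k
    rw [𝒱.oppositeCoeff_of_mem k h hv]
    simp only [expL, dividedPower, LinearMap.smul_apply, smul_smul, div_eq_mul_inv]
  let e : ℕ ↪ ℤ := ⟨fun j => j - 2 * h, fun a b hab => by simpa using hab⟩
  rw [opposite_apply, finsum_eq_sum_of_support_subset (s := (Finset.range J).map e), Finset.sum_map,
    Finset.smul_sum]
  · refine Finset.sum_congr rfl fun j _ => ?_
    have h₁ : e j = j - 2 * h := rfl
    have h₂ : (j : ℤ) - 2 * h + 2 * h = j := by ring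
    simp only [h₁, hk, h₂, Nat.cast_nonneg, if_true, Int.toNat_natCast,
      map_smul, Pi.smul_apply]
    congr 2
    exact congrArg _ (by ring)
  · intro k hk'
    rw [Function.mem_support, hk] at hk'
    by_cases h₀ : 0 ≤ k + 2 * h
    · rw [if_pos h₀] at hk'
      simp only [Finset.coe_map, Set.mem_image, Finset.coe_range, Set.mem_Iio]
      refine ⟨(k + 2 * h).toNat, ?_, ?_⟩
      · by_contra h₁
        exact hk' (by rw [hJ _ (by omega), smul_zero, map_zero, Pi.zero_apply])
      · change ((k + 2 * h).toNat : ℤ) - 2 * h = k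
        omega
    · exact absurd (by rw [if_neg h₀, map_zero, Pi.zero_apply]) hk'

end VertexOperatorAlgebra

/-! ### The Jacobi identity for opposite vertex operators -/

open Filter FormalCalculus

namespace VertexOperatorAlgebra

variable {V : Type*} [AddCommGroup V] [Module ℂ V] (𝒱 : VertexOperatorAlgebra V)
  {M : Type*} [AddCommGroup M] [Module ℂ M] {Y : Modes V M}

/-- The conjugation formula expands each divided power on the product. Since L(1) lowers weights and
modes are truncated, a finite box of indices (j, k, r) suffices, and summing by total degree becomes
summing over the box. -/
theorem opposite_mode {h h' : ℤ} {u v : V} (hu : u ∈ 𝒱.weightSpace h) (hv : v ∈ 𝒱.weightSpace h')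
    {J : ℕ} (hJu : ∀ j, J ≤ j → 𝒱.expL j u = 0) (hJv : ∀ j, J ≤ j → 𝒱.expL j v = 0) (i : ℤ) {K : ℕ}
    (hK : ∀ j k r : ℕ, K ≤ r → 𝒱.Y (𝒱.expL j u) (i + r) (𝒱.expL k v) = 0) (m : ℤ) (w : M) :
    𝒱.opposite Y (𝒱.Y u i v) m w = (-1 : ℂ) ^ (h + h' - i - 1) •
      ∑ j ∈ Finset.range J, ∑ k ∈ Finset.range J, ∑ r ∈ Finset.range K,
        ((Ring.choose (2 * h - 2 - i - j) r : ℤ) : ℂ) •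
          Y (𝒱.Y (𝒱.expL j u) (i + r) (𝒱.expL k v))
            (2 * (h + h' - i - 1) - 2 - m - j - r - k) w := by
  have hmem := 𝒱.mode_mem hu hv i
  obtain ⟨S, hS⟩ := 𝒱.expL_eq_zero hmem
  -- `S` makes the outer sum exhaust the nonzero divided powers, and J + K + J makes it reach every
  -- total degree of the box.
  rw [𝒱.opposite_eq_sum Y hmem (J := max S (J + K + J)) (fun j hj => hS j (by omega)) m,
    LinearMap.smul_apply, LinearMap.sum_apply]
  congr 1
  set c := 2 * (h + h' - i - 1) - 2 - m with hc
  let G : ℕ → ℕ → ℕ → M := fun k j r => ((Ring.choose (2 * h - 2 - i - j) r : ℤ) : ℂ) •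
    Y (𝒱.Y (𝒱.expL j u) (i + r) (𝒱.expL k v)) (c - j - r - k) w
  have hG : ∀ j k r, J ≤ j ∨ J ≤ k ∨ K ≤ r → G k j r = 0 := by
    rintro j k r (hj | hk | hr)
    · simp [G, hJu j hj]
    · simp [G, hJv k hk]
    · simp only [G, hK j k r hr, map_zero, Pi.zero_apply, LinearMap.zero_apply, smul_zero]
  have e : ∀ s ∈ Finset.range (max S (J + K + J)), Y (𝒱.expL s (𝒱.Y u i v)) (c - s) w =
      ∑ x ∈ Finset.HasAntidiagonal.antidiagonal s,
        ∑ y ∈ Finset.HasAntidiagonal.antidiagonal x.1, G x.2 y.1 y.2 := by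
    intro s _
    rw [𝒱.expL_mode hu, map_sum, Finset.sum_apply, LinearMap.sum_apply]
    refine Finset.sum_congr rfl fun x hx => ?_
    rw [map_sum, Finset.sum_apply, LinearMap.sum_apply]
    refine Finset.sum_congr rfl fun y hy => ?_
    rw [← Finset.HasAntidiagonal.mem_antidiagonal.1 hx,
      ← Finset.HasAntidiagonal.mem_antidiagonal.1 hy, map_smul, Pi.smul_apply,
      LinearMap.smul_apply]
    simp only [G]
    congr 3
    push_cast
    exact congrArg _ (by ring)
  rw [Finset.sum_congr rfl e, Finset.sum_range_antidiagonal
    (fun a b => ∑ y ∈ Finset.HasAntidiagonal.antidiagonal a, G b y.1 y.2) (J + K) J _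
    (le_max_right _ _)]
  · rw [Finset.sum_comm]
    conv_rhs => rw [Finset.sum_comm]
    refine Finset.sum_congr rfl fun k _ => ?_
    exact Finset.sum_range_antidiagonal (G k) J K _ le_rfl (fun j r hj => hG _ _ _ (Or.inl hj))
      fun j r hr => hG _ _ _ (Or.inr (Or.inr hr))
  · intro a b ha
    refine Finset.sum_eq_zero fun y hy => hG _ _ _ ?_
    have := Finset.HasAntidiagonal.mem_antidiagonal.1 hy
    omega
  · intro a b hb
    exact Finset.sum_eq_zero fun y hy => hG _ _ _ (Or.inr (Or.inl hb))

theorem opposite_eventually (hT : LowerTruncated Y) (v : V) (w : M) :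
    ∀ᶠ n in atBot, 𝒱.opposite Y v n w = 0 :=
  eventually_atBot.2 (𝒱.opposite_truncation hT v w)

theorem altSum_opposite (hT : LowerTruncated Y) {h h' : ℤ} {u v : V}
    (hu : u ∈ 𝒱.weightSpace h) (hv : v ∈ 𝒱.weightSpace h') {J : ℕ}
    (hJu : ∀ j, J ≤ j → 𝒱.expL j u = 0) (hJv : ∀ j, J ≤ j → 𝒱.expL j v = 0) (w : M)
    (l m n : ℤ) :
    altSum l (fun i => 𝒱.opposite Y u (m + i) (𝒱.opposite Y v (l + n - i) w)) =
      (-1 : ℂ) ^ (h + h') • ∑ j ∈ Finset.range J, ∑ k ∈ Finset.range J, altSum l fun i =>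
        Y (𝒱.expL j u) (2 * h - 2 - m - j - i)
          (Y (𝒱.expL k v) (2 * h' - 2 - n - l - k + i) w) := by
  have hfin : ∀ j k, ∀ᶠ i : ℕ in atTop, Y (𝒱.expL j u) (2 * h - 2 - m - j - i)
      (Y (𝒱.expL k v) (2 * h' - 2 - n - l - k + i) w) = 0 := by
    intro j k
    obtain ⟨N, hN⟩ := hT (𝒱.expL k v) w
    exact eventually_atTop.2 ⟨(N - (2 * h' - 2 - n - l - k)).toNat, fun i hi => by
      rw [hN _ (by omega), map_zero]⟩
  have hfin' : ∀ j ∈ Finset.range J, ∀ᶠ i : ℕ in atTop, ∑ k ∈ Finset.range J,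
      Y (𝒱.expL j u) (2 * h - 2 - m - j - i)
        (Y (𝒱.expL k v) (2 * h' - 2 - n - l - k + i) w) = 0 := by
    intro j _
    filter_upwards [(eventually_all_finset (Finset.range J)).2 fun k _ => hfin j k] with i hi
    exact Finset.sum_eq_zero hi
  have hfin'' : ∀ᶠ i : ℕ in atTop, ∑ j ∈ Finset.range J, ∑ k ∈ Finset.range J,
      Y (𝒱.expL j u) (2 * h - 2 - m - j - i)
        (Y (𝒱.expL k v) (2 * h' - 2 - n - l - k + i) w) = 0 := by
    filter_upwards [(eventually_all_finset (Finset.range J)).2 hfin'] with i hi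
    exact Finset.sum_eq_zero hi
  rw [Finset.sum_congr rfl fun j _ => (altSum_sum l (Finset.range J) fun k _ => hfin j k).symm,
    ← altSum_sum l (Finset.range J) hfin', ← altSum_smul l _ hfin'']
  congr 1
  funext i
  rw [𝒱.opposite_eq_sum Y hu hJu, 𝒱.opposite_eq_sum Y hv hJv, zpow_add₀ (by norm_num), mul_smul]
  simp only [LinearMap.smul_apply, LinearMap.sum_apply, map_smul, map_sum]
  rw [← Finset.smul_sum, smul_comm]
  congr 2
  rw [Finset.sum_comm]
  refine Finset.sum_congr rfl fun j _ => Finset.sum_congr rfl fun k _ => ?_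
  congr 1
  · exact congrArg _ (by ring)
  · congr 1
    exact congrArg _ (by ring)

/-- Both sides expand over pairs (j, k) of divided powers of L(1) on u and v. For each pair, the
identity is the ordinary Jacobi identity of Y after inverting the variables, which reverses the
products. -/
theorem opposite_jacobi_of_mem (hT : LowerTruncated Y) (hY : JacobiIdentity 𝒱.Y Y) {h h' : ℤ}
    {u v : V} (hu : u ∈ 𝒱.weightSpace h) (hv : v ∈ 𝒱.weightSpace h') (w : M) (l m n : ℤ) :
    altSum l (fun i => 𝒱.opposite Y v (n + i) (𝒱.opposite Y u (l + m - i) w))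
      - (-1 : ℂ) ^ l • altSum l (fun i => 𝒱.opposite Y u (m + i) (𝒱.opposite Y v (l + n - i) w))
      = binomSum m fun i => 𝒱.opposite Y (𝒱.Y u (l + i) v) (m + n - i) w := by
  obtain ⟨J₁, hJ₁⟩ := 𝒱.expL_eq_zero hu
  obtain ⟨J₂, hJ₂⟩ := 𝒱.expL_eq_zero hv
  obtain ⟨J, hJu, hJv⟩ : ∃ J : ℕ, (∀ j, J ≤ j → 𝒱.expL j u = 0) ∧ ∀ j, J ≤ j → 𝒱.expL j v = 0 :=
    ⟨max J₁ J₂, fun j hj => hJ₁ j (by omega), fun j hj => hJ₂ j (by omega)⟩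
  obtain ⟨K, hK, hK'⟩ : ∃ K : ℕ, (∀ j k t : ℕ, K ≤ t →
      𝒱.Y (𝒱.expL j u) (l + t) (𝒱.expL k v) = 0) ∧ ∀ t : ℕ, K ≤ t → 𝒱.Y u (l + t) v = 0 := by
    have h₁ : ∀ᶠ t : ℕ in atTop, ∀ j ∈ Finset.range J, ∀ k ∈ Finset.range J,
        𝒱.Y (𝒱.expL j u) (l + t) (𝒱.expL k v) = 0 :=
      (eventually_all_finset _).2 fun j _ => (eventually_all_finset _).2 fun k _ =>
        eventually_add (eventually_atTop.2 (𝒱.truncation _ _)) l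
    have h₂ : ∀ᶠ t : ℕ in atTop, 𝒱.Y u (l + t) v = 0 :=
      eventually_add (eventually_atTop.2 (𝒱.truncation _ _)) l
    obtain ⟨K, hK⟩ := eventually_atTop.1 (h₁.and h₂)
    refine ⟨K, fun j k t ht => ?_, fun t ht => (hK t ht).2⟩
    by_cases hj : j < J
    · by_cases hk : k < J
      · exact (hK t ht).1 j (Finset.mem_range.2 hj) k (Finset.mem_range.2 hk)
      · rw [hJv k (by omega), map_zero]
    · rw [hJu j (by omega)]
      simp
  have hl : ∀ a : ℤ, ((-1 : ℂ) ^ a) * (-1) ^ a = 1 := fun a => by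
    rw [← mul_zpow, neg_one_mul, neg_neg, one_zpow]
  let G : ℕ → ℕ → ℕ → M := fun j k t => Y (𝒱.Y (𝒱.expL j u) (l + t) (𝒱.expL k v))
    (2 * (h + h' - l) - 4 - m - n - j - k - t) w
  have hG : ∀ j k t, K ≤ t → G j k t = 0 := fun j k t ht => by
    simp only [G, hK j k t ht, map_zero, Pi.zero_apply, LinearMap.zero_apply]
  have hRHS : (binomSum m fun i => 𝒱.opposite Y (𝒱.Y u (l + i) v) (m + n - i) w) =
      -((-1 : ℂ) ^ l * (-1) ^ (h + h')) • ∑ j ∈ Finset.range J, ∑ k ∈ Finset.range J,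
        binomSum (2 * h - 2 - l - j - m) fun t => G j k t := by
    -- The binomials of the iterate (index i) and of the conjugation formula (index r) multiply
    -- vectors depending only on i + r, so `Ring.sum_antidiagonal_choose_sub` merges them.
    have e₁ : ∀ j k : ℕ, (binomSum (2 * h - 2 - l - j - m) fun t => G j k t) =
        ∑ i ∈ Finset.range K, ∑ r ∈ Finset.range K,
          (((-1) ^ i * Ring.choose m i * Ring.choose (2 * h - 2 - l - j - i) r : ℤ) : ℂ) •
            G j k (i + r) := by
      intro j k
      rw [binomSum_eq_sum_range _ (K := K + K) fun t ht => hG j k t (by omega),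
        ← Finset.sum_range_antidiagonal (fun i r => (((-1) ^ i * Ring.choose m i *
          Ring.choose (2 * h - 2 - l - j - i) r : ℤ) : ℂ) • G j k (i + r)) K K _ le_rfl
          (fun i r hi => by rw [hG j k _ (by omega), smul_zero])
          (fun i r hr => by rw [hG j k _ (by omega), smul_zero])]
      refine Finset.sum_congr rfl fun t _ => ?_
      rw [← Ring.sum_antidiagonal_choose_sub, Int.cast_sum, Finset.sum_smul]
      refine Finset.sum_congr rfl fun x hx => ?_
      rw [Finset.HasAntidiagonal.mem_antidiagonal.1 hx]
    rw [binomSum_eq_sum_range m (K := K) fun i hi => by rw [hK' i hi]; simp]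
    simp only [e₁]
    rw [Finset.sum_congr rfl fun j _ => Finset.sum_comm, Finset.sum_comm, Finset.smul_sum]
    refine Finset.sum_congr rfl fun i _ => ?_
    rw [𝒱.opposite_mode hu hv hJu hJv (l + i) (K := K)
      fun j k r hr => by have := hK j k (i + r) (by omega); push_cast at this; rwa [add_assoc]]
    simp only [Finset.smul_sum, smul_smul]
    refine Finset.sum_congr rfl fun j _ => Finset.sum_congr rfl fun k _ =>
      Finset.sum_congr rfl fun r _ => ?_
    have hs : (-1 : ℂ) ^ (h + h' - (l + i) - 1) = -((-1) ^ l * (-1) ^ (h + h') * (-1) ^ i) := by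
      rw [zpow_sub_one₀ (by norm_num), zpow_sub₀ (by norm_num), zpow_add₀ (by norm_num) l i,
        zpow_natCast, inv_neg, inv_one, mul_neg_one, div_eq_mul_inv]
      congr 1
      have : ((-1 : ℂ) ^ l * (-1) ^ i)⁻¹ = (-1) ^ l * (-1) ^ i := by
        refine inv_eq_of_mul_eq_one_left ?_
        rw [← zpow_natCast, mul_mul_mul_comm, hl, hl, one_mul]
      rw [this]
      ring
    simp only [G]
    congr 1
    · rw [hs, show 2 * h - 2 - (l + i) - (j : ℤ) = 2 * h - 2 - l - j - i by ring]
      push_cast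
      ring
    · rw [show l + (i : ℤ) + r = l + (i + r : ℕ) by push_cast; ring]
      congr 1
      exact congrArg _ (by push_cast; ring)
  have hsum : ∀ j k : ℕ,
      (altSum l fun i => Y (𝒱.expL j u) (2 * h - 2 - m - j - i)
          (Y (𝒱.expL k v) (2 * h' - 2 - n - l - k + i) w)) -
        (-1 : ℂ) ^ l • (altSum l fun i => Y (𝒱.expL k v) (2 * h' - 2 - n - k - i)
          (Y (𝒱.expL j u) (2 * h - 2 - m - l - j + i) w)) =
        binomSum (2 * h - 2 - l - j - m) fun t => G j k t := by
    intro j k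
    -- The exponents reflect m and n under inversion; the extra -l in each comes from (x₁⁻¹ -
    -- x₂⁻¹)^l = (-1)^l (x₁ - x₂)^l (x₁ x₂)^{-l}.
    have := hY (𝒱.expL j u) (𝒱.expL k v) w l (2 * h - 2 - m - l - j) (2 * h' - 2 - n - l - k)
    rw [← altSum_eq_finsum, ← altSum_eq_finsum] at this
    convert this using 2
    · congr 1
      funext i
      congr 1
      exact congrArg _ (by ring)
    · congr 2
      funext i
      congr 1
      exact congrArg _ (by ring)
    · refine finsum_congr fun t => ?_
      rw [show 2 * h - 2 - l - j - m = 2 * h - 2 - m - l - j by ring]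
      congr 1
      simp only [G]
      congr 1
      exact congrArg _ (by ring)
  rw [hRHS, Finset.sum_congr rfl fun j _ => Finset.sum_congr rfl fun k _ => (hsum j k).symm,
    𝒱.altSum_opposite hT hu hv hJu hJv, 𝒱.altSum_opposite hT hv hu hJv hJu,
    Finset.sum_comm (s := Finset.range J), add_comm h' h]
  simp only [Finset.sum_sub_distrib, ← Finset.smul_sum, smul_sub, smul_smul]
  rw [neg_mul, mul_right_comm, hl l, one_mul]
  simp only [neg_smul]
  abel

theorem opposite_jacobi (hT : LowerTruncated Y) (hY : JacobiIdentity 𝒱.Y Y)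
    (u v : V) (w : M) (l m n : ℤ) :
    altSum l (fun i => 𝒱.opposite Y v (n + i) (𝒱.opposite Y u (l + m - i) w))
      - (-1 : ℂ) ^ l • altSum l (fun i => 𝒱.opposite Y u (m + i) (𝒱.opposite Y v (l + n - i) w))
      = binomSum m fun i => 𝒱.opposite Y (𝒱.Y u (l + i) v) (m + n - i) w := by
  have f₁ : ∀ u v : V, ∀ l m n : ℤ, ∀ᶠ i : ℕ in atTop,
      𝒱.opposite Y v (n + i) (𝒱.opposite Y u (l + m - i) w) = 0 := fun u v l m n => by
    filter_upwards [eventually_sub (𝒱.opposite_eventually hT u w) (l + m)] with i hi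
    rw [hi, map_zero]
  have f₂ : ∀ u v : V, ∀ᶠ i : ℕ in atTop,
      𝒱.opposite Y (𝒱.Y u (l + i) v) (m + n - i) w = 0 := fun u v => by
    filter_upwards [eventually_add (eventually_atTop.2 (𝒱.truncation u v)) l] with i hi
    rw [hi, map_zero, Pi.zero_apply, LinearMap.zero_apply]
  have htop : ∀ x : V, x ∈ ⨆ h, 𝒱.weightSpace h := fun x => by
    have := 𝒱.grading.submodule_iSup_eq_top
    change (⨆ h, 𝒱.weightSpace h) = ⊤ at this
    rw [this]
    trivial
  induction htop u using Submodule.iSup_induction' with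
  | mem h u hu =>
    induction htop v using Submodule.iSup_induction' with
    | mem h' v hv => exact 𝒱.opposite_jacobi_of_mem hT hY hu hv w l m n
    | zero => simp [altSum_eq_zero, binomSum_eq_zero]
    | add v v' _ _ e e' =>
      simp only [map_add, Pi.add_apply, LinearMap.add_apply]
      rw [altSum_add _ (f₁ _ _ _ _ _) (f₁ _ _ _ _ _), altSum_add _ (f₁ _ _ _ _ _) (f₁ _ _ _ _ _),
        binomSum_add _ (f₂ _ _) (f₂ _ _), ← e, ← e', smul_add]
      abel
  | zero => simp [altSum_eq_zero, binomSum_eq_zero]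
  | add u u' _ _ e e' =>
    simp only [map_add, Pi.add_apply, LinearMap.add_apply]
    rw [altSum_add _ (f₁ _ _ _ _ _) (f₁ _ _ _ _ _), altSum_add _ (f₁ _ _ _ _ _) (f₁ _ _ _ _ _),
      binomSum_add _ (f₂ _ _) (f₂ _ _), ← e, ← e', smul_add]
    abel

end VertexOperatorAlgebra

/-! ### Modes on the tensor square -/

open Filter FormalCalculus

namespace VertexOperatorAlgebra

variable {V : Type*} [AddCommGroup V] [Module ℂ V] (𝒱 : VertexOperatorAlgebra V)

theorem tensorSquare_Y (u v a b : V) (n : ℤ) :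
    𝒱.tensorSquare.Y (u ⊗ₜ[ℂ] v) n (a ⊗ₜ[ℂ] b) =
      ∑ᶠ i : ℤ, 𝒱.Y u i a ⊗ₜ[ℂ] 𝒱.Y v (n - 1 - i) b := rfl

theorem tensorSquare_left (u v : V) (n : ℤ) :
    𝒱.tensorSquare.Y (u ⊗ₜ[ℂ] 𝒱.vacuum) n (v ⊗ₜ[ℂ] 𝒱.vacuum) = 𝒱.Y u n v ⊗ₜ[ℂ] 𝒱.vacuum := by
  rw [tensorSquare_Y, finsum_eq_single _ n]
  · rw [𝒱.vacuum_mode, if_pos (by ring), Module.End.one_apply]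
  · intro i hi
    rw [𝒱.vacuum_mode, if_neg (by omega), LinearMap.zero_apply, TensorProduct.tmul_zero]

theorem tensorSquare_right (u v : V) (n : ℤ) :
    𝒱.tensorSquare.Y (𝒱.vacuum ⊗ₜ[ℂ] u) n (𝒱.vacuum ⊗ₜ[ℂ] v) = 𝒱.vacuum ⊗ₜ[ℂ] 𝒱.Y u n v := by
  rw [tensorSquare_Y, finsum_eq_single _ (-1)]
  · rw [𝒱.vacuum_mode, if_pos rfl, Module.End.one_apply, sub_neg_eq_add, sub_add_cancel]
  · intro i hi
    rw [𝒱.vacuum_mode, if_neg hi, LinearMap.zero_apply, TensorProduct.zero_tmul]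

/-- Either i ≥ 0 and the mode of u kills the vacuum, or n - 1 - i ≥ 0 and the vacuum mode is zero.
This is what makes the two actions on A commute. -/
theorem tensorSquare_mixed (u v : V) (n : ℕ) :
    𝒱.tensorSquare.Y (u ⊗ₜ[ℂ] 𝒱.vacuum) n (𝒱.vacuum ⊗ₜ[ℂ] v) = 0 := by
  rw [tensorSquare_Y]
  refine finsum_eq_zero_of_forall_eq_zero fun i => ?_
  by_cases hi : 0 ≤ i
  · rw [𝒱.creation_nonneg u i hi, TensorProduct.zero_tmul]
  · rw [𝒱.vacuum_mode, if_neg (by omega), LinearMap.zero_apply, TensorProduct.tmul_zero]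

theorem vacuum_mem : 𝒱.vacuum ∈ 𝒱.weightSpace 0 := by
  rw [weightSpace, Module.End.mem_eigenspace_iff, 𝒱.creation_nonneg _ _ zero_le_one]
  simp

theorem opposite_vacuum {M : Type*} [AddCommGroup M] [Module ℂ M] {Y : Modes V M}
    (hY : ∀ n : ℤ, Y 𝒱.vacuum n = if n = -1 then 1 else 0) (m : ℤ) :
    𝒱.opposite Y 𝒱.vacuum m = if m = -1 then 1 else 0 := by
  have h : ∀ j, 1 ≤ j → 𝒱.expL j 𝒱.vacuum = 0 := by
    intro j hj
    obtain ⟨j, rfl⟩ := Nat.exists_eq_add_of_le' hj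
    rw [expL, dividedPower, LinearMap.smul_apply, pow_succ, Module.End.mul_apply, L,
      𝒱.creation_nonneg _ _ (by norm_num), map_zero, smul_zero]
  rw [𝒱.opposite_eq_sum Y 𝒱.vacuum_mem h, Finset.sum_range_one, zpow_zero, one_smul, expL,
    dividedPower_zero, hY]
  refine if_congr ?_ rfl rfl
  push_cast
  omega

end VertexOperatorAlgebra

/-! ### Locality, stability and the weak module structure -/

namespace WeakModule

variable {V : Type*} [AddCommGroup V] [Module ℂ V] {𝒱 : VertexOperatorAlgebra V}
  {A : Type*} [AddCommGroup A] [Module ℂ A] (𝒜 : WeakModule 𝒱.tensorSquare A)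

theorem Y₁_truncation : LowerTruncated 𝒜.Y₁ := fun v => 𝒜.truncation (v ⊗ₜ[ℂ] 𝒱.vacuum)

theorem Y₂_truncation : LowerTruncated 𝒜.Y₂ := fun v => 𝒜.truncation (𝒱.vacuum ⊗ₜ[ℂ] v)

theorem Y₁_jacobi : JacobiIdentity 𝒱.Y 𝒜.Y₁ := fun u v w l m n => by
  have := 𝒜.jacobi (u ⊗ₜ[ℂ] 𝒱.vacuum) (v ⊗ₜ[ℂ] 𝒱.vacuum) w l m n
  simpa only [Y₁_apply, 𝒱.tensorSquare_left] using this

theorem Y₂_jacobi : JacobiIdentity 𝒱.Y 𝒜.Y₂ := fun u v w l m n => by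
  have := 𝒜.jacobi (𝒱.vacuum ⊗ₜ[ℂ] u) (𝒱.vacuum ⊗ₜ[ℂ] v) w l m n
  simpa only [Y₂_apply, 𝒱.tensorSquare_right] using this

theorem Y₁_Y₂_commute (u v : V) (m n : ℤ) (w : A) :
    𝒜.Y₁ u m (𝒜.Y₂ v n w) = 𝒜.Y₂ v n (𝒜.Y₁ u m w) := by
  have := 𝒜.jacobi (u ⊗ₜ[ℂ] 𝒱.vacuum) (𝒱.vacuum ⊗ₜ[ℂ] v) w 0 m n
  rw [← altSum_eq_finsum, ← altSum_eq_finsum, altSum_zero_left, altSum_zero_left] at this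
  simp only [zero_add, 𝒱.tensorSquare_mixed, map_zero, Pi.zero_apply, LinearMap.zero_apply,
    smul_zero, finsum_zero, zpow_zero, one_smul, Nat.cast_zero, add_zero, sub_zero] at this
  exact sub_eq_zero.1 this

/-- The opposite of `Y₁` together with `Y₂`. -/
noncomputable def oppositePair : OppositePair 𝒱.Y A where
  P := 𝒱.opposite 𝒜.Y₁
  Q := 𝒜.Y₂
  truncation := 𝒱.truncation
  truncation_P := 𝒱.opposite_eventually 𝒜.Y₁_truncation
  truncation_Q v a := eventually_atTop.2 (𝒜.Y₂_truncation v a)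
  jacobi_P := 𝒱.opposite_jacobi 𝒜.Y₁_truncation 𝒜.Y₁_jacobi
  jacobi_Q u v a l p q := by
    rw [altSum_eq_finsum, altSum_eq_finsum]
    exact 𝒜.Y₂_jacobi u v a l p q
  commute u v m n a := by
    have h : ∀ b, 𝒱.opposite 𝒜.Y₁ u m b =
        ∑ᶠ k : ℤ, 𝒜.Y₁ (𝒱.oppositeCoeff k u) (-m - 2 - k) b := fun b => by
      change LinearMap.applyₗ b (𝒱.opposite 𝒜.Y₁ u m) = _
      rw [𝒱.opposite_apply, map_finsum _ (𝒱.opposite_finite ..)]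
      rfl
    have hfin : (Function.support fun k : ℤ =>
        𝒜.Y₁ (𝒱.oppositeCoeff k u) (-m - 2 - k) a).Finite :=
      (𝒱.opposite_finite 𝒜.Y₁ u m).subset fun k hk hk' => hk (by
        simp only at hk' ⊢
        rw [hk', LinearMap.zero_apply])
    rw [h, h, map_finsum _ hfin]
    simp only [𝒜.Y₁_Y₂_commute]

theorem deltaCoeff_eq_gap (z : ℂ) (f : Module.Dual ℂ A) (v : V) (a : A) (p q : ℤ) :
    𝒜.deltaCoeff z f v a p q = 𝒜.oppositePair.gap z f v a p q := by
  rw [OppositePair.gap, OppositePair.PM_apply, OppositePair.QM_apply,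
    map_atInfinity z (𝒜.oppositePair.truncation_P v a),
    map_atOrigin z (𝒜.oppositePair.truncation_Q v a)]
  simp only [deltaCoeff, atInfinity, atOrigin, binomSum]
  congr 1
  · refine finsum_congr fun i => ?_
    rw [firstTerm, mul_assoc]
    rfl
  · rw [smul_finsum]
    refine finsum_congr fun i => ?_
    simp only [secondTerm, smul_eq_mul, mul_assoc]
    rfl

theorem YQ_eq_dualMode (z : ℂ) (v : V) (p : ℤ) (f : Module.Dual ℂ A) :
    𝒜.YQ z v p f = 𝒜.oppositePair.dualMode z v p f := by
  ext a
  rw [YQ_apply, deltaCoeff_eq_gap, OppositePair.dualMode_apply]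

/-- The `Q(z)`-compatibility condition amounts to locality. -/
theorem qCompatible_iff {z : ℂ} (hz : z ≠ 0) (f : Module.Dual ℂ A) :
    𝒜.QCompatible z f ↔ 𝒜.oppositePair.IsLocal z f := by
  constructor
  · intro h v
    obtain ⟨N, hN⟩ := h.lower_truncation v
    -- Condition (b) expresses the gap at (p, q) through modes of index at least p, so the
    -- truncation bound for f serves all q and a.
    refine eventually_atTop.2 ⟨N, fun p hp q a => ?_⟩
    rw [← deltaCoeff_eq_gap, ← h.jacobi]
    refine finsum_eq_zero_of_forall_eq_zero fun i => ?_
    rw [hN _ (by omega), LinearMap.zero_apply, mul_zero]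
  · intro h
    have hv : ∀ v, ∃ N : ℤ, ∀ p : ℤ, N ≤ p → 𝒜.YQ z v p f = 0 := by
      intro v
      obtain ⟨N, hN⟩ := eventually_atTop.1 (h v)
      refine ⟨N, fun p hp => ?_⟩
      ext a
      rw [YQ_apply, deltaCoeff_eq_gap, hN p hp, LinearMap.zero_apply]
    refine ⟨hv, fun v a p q => ?_⟩
    obtain ⟨N, hN⟩ := hv v
    have hfin : ∀ c : ℕ → ℂ, ∀ p : ℤ, ∀ᶠ i : ℕ in atTop, c i • 𝒜.YQ z v (p + i) f a = 0 :=
      fun c p => eventually_atTop.2 ⟨(N - p).toNat, fun i hi => by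
        rw [hN _ (by omega), LinearMap.zero_apply, smul_zero]⟩
    -- The left side of (b) is the pairing with x^q = (z + y)^q expanded at y = 0. It obeys the
    -- recurrence of the gap, agrees with it at q = 0, and both vanish for large p, so uniqueness
    -- applies.
    have hX : IsShift z fun p q =>
        binomSum q fun i => z ^ (q - i) • 𝒜.YQ z v (p + i) f a := by
      intro p q
      simp only
      rw [binomSum_succ _ (hfin _ _), ← binomSum_smul _ _ (hfin _ _), add_sub_right_comm]
      refine (zero_add _).symm.trans (congrArg₂ _ (sub_eq_zero.2 ?_).symm ?_)
      · congr 1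
        funext i
        rw [smul_smul, add_sub_right_comm, zpow_add_one₀ hz, mul_comm]
      · congr 1
        funext i
        push_cast
        rw [add_sub_add_right_eq_sub, add_assoc, add_comm 1 (i : ℤ)]
    have := (hX.sub (𝒜.oppositePair.gap_isShift hz f v a)).eq_zero_of_right hz
      (fun p => ?_) (fun q => ?_) p q
    · rw [𝒜.deltaCoeff_eq_gap, ← sub_eq_zero.1 this]
      simp only [binomSum, smul_eq_mul, mul_assoc]
    · rw [binomSum_zero_left, YQ_apply, deltaCoeff_eq_gap]
      simp
    · filter_upwards [h v, eventually_ge_atTop N] with p hp hp'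
      rw [hp, sub_zero]
      exact binomSum_eq_zero q fun i => by
        rw [hN _ (by omega), LinearMap.zero_apply, smul_zero]

/-- P and Q of the vacuum are both the identity, so the mode is the x⁻¹ coefficient of (x - z)^n at
infinity minus that at 0. The latter is always 0; the former is 1 for n = -1 and 0 otherwise. -/
theorem YQ_vacuum (z : ℂ) (n : ℤ) : 𝒜.YQ z 𝒱.vacuum n = if n = -1 then 1 else 0 := by
  have hP : ∀ m a, 𝒜.oppositePair.P 𝒱.vacuum m a = if m = -1 then a else 0 := by
    intro m a
    change 𝒱.opposite 𝒜.Y₁ 𝒱.vacuum m a = _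
    rw [𝒱.opposite_vacuum fun n => 𝒜.vacuum_mode n]
    split_ifs <;> rfl
  have hQ : ∀ m a, 𝒜.oppositePair.Q 𝒱.vacuum m a = if m = -1 then a else 0 := by
    intro m a
    change 𝒜.Y (𝒱.vacuum ⊗ₜ[ℂ] 𝒱.vacuum) m a = _
    have := 𝒜.vacuum_mode m
    change 𝒜.Y (𝒱.vacuum ⊗ₜ[ℂ] 𝒱.vacuum) m = _ at this
    rw [this]
    split_ifs <;> rfl
  have hQM : ∀ a, 𝒜.oppositePair.QM z 𝒱.vacuum n 0 a = 0 := fun a => by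
    rw [OppositePair.QM_apply]
    refine atOrigin_eq_zero z (K := 0) (fun m hm => ?_) le_rfl
    rw [hQ, if_neg (by omega)]
  have hPM : ∀ a, 𝒜.oppositePair.PM z 𝒱.vacuum n 0 a = if n = -1 then a else 0 := by
    intro a
    simp only [OppositePair.PM_apply, hP, atInfinity, add_zero]
    by_cases hn : n = -1
    · rw [if_pos hn, binomSum, finsum_eq_single _ 0]
      · simp [hn]
      · intro i hi
        rw [if_neg (by omega), smul_zero, smul_zero]
    · rw [if_neg hn]
      by_cases hn' : 0 ≤ n
      · lift n to ℕ using hn'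
        rw [VertexOperatorAlgebra.binomSum_natCast]
        refine Finset.sum_eq_zero fun i hi => ?_
        rw [Finset.mem_range] at hi
        rw [if_neg (by omega), smul_zero, smul_zero]
      · exact binomSum_eq_zero n fun i => by rw [if_neg (by omega), smul_zero]
  ext f a
  rw [YQ_eq_dualMode, OppositePair.dualMode_apply, OppositePair.gap, hPM, hQM, map_zero, sub_zero]
  split_ifs <;> simp

/-- The modes of `Y'_{Q(z)}` on the space of compatible functionals. -/
noncomputable def compatibleModes {z : ℂ} (hz : z ≠ 0) : Modes V (𝒜.TQ z) where
  toFun v n := (𝒜.YQ z v n).restrict (p := 𝒜.TQ z) (q := 𝒜.TQ z) fun f hf => by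
    rw [YQ_eq_dualMode]
    exact (𝒜.qCompatible_iff hz _).2
      (OppositePair.IsLocal.dualMode _ hz ((𝒜.qCompatible_iff hz f).1 hf) v n)
  map_add' u v := by
    funext n
    ext f a
    simp
  map_smul' c v := by
    funext n
    ext f a
    simp

theorem coe_compatibleModes {z : ℂ} (hz : z ≠ 0) (v : V) (n : ℤ) (f : 𝒜.TQ z) :
    (𝒜.compatibleModes hz v n f : Module.Dual ℂ A) = 𝒜.YQ z v n f := rfl

theorem compatibleModes_truncation {z : ℂ} (hz : z ≠ 0) :
    LowerTruncated (𝒜.compatibleModes hz) := fun v f => by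
  obtain ⟨N, hN⟩ := QCompatible.lower_truncation f.2 v
  exact ⟨N, fun n hn => Subtype.ext (hN n hn)⟩

theorem compatibleModes_jacobi {z : ℂ} (hz : z ≠ 0) :
    JacobiIdentity 𝒱.Y (𝒜.compatibleModes hz) := by
  intro u v f l m n
  refine Subtype.ext (LinearMap.ext fun a => ?_)
  let ev : 𝒜.TQ z →ₗ[ℂ] ℂ := LinearMap.applyₗ a ∘ₗ (𝒜.TQ z).subtype
  have ev_apply : ∀ g : 𝒜.TQ z, ev g = (g : Module.Dual ℂ A) a := fun _ => rfl
  have hfin : ∀ (u v : V) (s t : ℤ), ∀ᶠ i : ℕ in atTop,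
      𝒜.compatibleModes hz u (s - i) (𝒜.compatibleModes hz v (t + i) f) = 0 := by
    intro u v s t
    filter_upwards [eventually_add
      (eventually_atTop.2 (𝒜.compatibleModes_truncation hz v f)) t] with i hi
    rw [hi, map_zero]
  have hfin' : ∀ᶠ i : ℕ in atTop,
      𝒜.compatibleModes hz (𝒱.Y u (l + i) v) (m + n - i) f = 0 := by
    filter_upwards [eventually_add (eventually_atTop.2 (𝒱.truncation u v)) l] with i hi
    rw [hi, map_zero, Pi.zero_apply, LinearMap.zero_apply]
  have := 𝒜.oppositePair.jacobi_dualMode hz ((𝒜.qCompatible_iff hz _).1 f.2) u v a l m n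
  rw [← ev_apply, ← ev_apply, ← altSum_eq_finsum, ← altSum_eq_finsum]
  -- Evaluation at a passes through the sums because they are already finite in the space of
  -- functionals: truncation holds independently of a.
  change ev (_ - _) = ev (binomSum m fun i => _)
  rw [map_sub, map_smul, map_altSum l (hfin ..), map_altSum l (hfin ..), map_binomSum m hfin']
  simpa only [ev_apply, coe_compatibleModes, YQ_eq_dualMode] using this

end WeakModule

theorem theorem5p7 {V : Type*} [AddCommGroup V] [Module ℂ V] (𝒱 : VertexOperatorAlgebra V)
    {A : Type*} [AddCommGroup A] [Module ℂ A] (𝒜 : WeakModule 𝒱.tensorSquare A)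
    (z : ℂ) (hz : z ≠ 0) :
    ∃ T : WeakModule 𝒱.toVertexData (𝒜.TQ z),
      ∀ (v : V) (n : ℤ) (f : 𝒜.TQ z),
        ((T.Y v n f : 𝒜.TQ z) : Module.Dual ℂ A) = 𝒜.YQ z v n (f : Module.Dual ℂ A) := by
  refine ⟨⟨𝒜.compatibleModes hz, 𝒜.compatibleModes_truncation hz, fun n => ?_,
    𝒜.compatibleModes_jacobi hz⟩, 𝒜.coe_compatibleModes hz⟩
  ext f : 2
  rw [𝒜.coe_compatibleModes, 𝒜.YQ_vacuum]
  split_ifs <;> rfl
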